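/- Let $k\ge 1$ and let $x_1,x_2,\dots$ be independent observations from an arbitrary probability distribution on $\mathbb R^k$ with distribution function $F$. Let $D_{r}$ be the space of $r$ times continuously differentiable real functions on $\mathbb R^k$ with compact support, with its usual topology. For $\psi\in D_{l+k}$ the generalized density $f=\partial^kF/\partial x_1\cdots\partial x_k$ is given by $(f,\psi)=(-1)^k\int F(x)\,\frac{\partial^k\psi}{\partial x_1\cdots\partial x_k}(x)\,dx$. Let $K$ be a bounded kernel of order $l$ on $\mathbb R^k$ with support in $[-1,1]^k$: $\int K=1$, $\int w_1^{j_1}\cdots w_k^{j_k}K(w)\,dw=0$ whenever $0<j_1+\dots+j_k<l$, and these integrals are finite when $j_1+\dots+j_k=l$. For bandwidth vectors $h=h(n)$ with positive components and $\bar h=\max_j h_j$, let $$\hat f(x)=\frac1{n\prod_j h_j}\sum_{i=1}^n K\Big(\frac{x_{i1}-x_1}{h_1},\dots,\frac{x_{ik}-x_k}{h_k}\Big),\qquad (\hat f,\psi)=\int\hat f\,\psi,$$ $$(B(h,K),\psi)=(-1)^{l+k}\sum_{m_1+\dots+m_k=l}\ \prod_{i=1}^k\frac{(h_i/\bar h)^{m_i}}{m_i!}\int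 F(x)\frac{\partial^{l+k}\psi}{\partial x_1^{m_1+1}\cdots\partial x_k^{m_k+1}}(x)\,dx\int K(w)\,w_1^{m_1}\cdots w_k^{m_k}\,dw .$$ A generalized random process is a random continuous linear functional on $D_{l+k}$; convergence of such processes means convergence in distribution of the random vectors of values at every finite set of test functions in $D_{l+k}$. **Theorem 2.** If $\bar h\to0$ and $n\bar h^{2l}=O(1)$ as $n\to\infty$, then $\sqrt n\,(\hat f-f-\bar h^{\,l}B(h,K))$ converges, as a generalized random process, to a generalized Gaussian process with mean functional zero and covariance functional $C(\psi_1,\psi_2)=\operatorname{cov}(\psi_1(x),\psi_2(x))$ for $\psi_1,\psi_2\in D_{l+k}$, where $x$ has distribution $F$. If $\bar h\to0$ and $n\bar h^{2l}\to0$, then $\sqrt n\,(\hat f-f)$ converges, as a generalized random process, to such a generalized Gaussian process. -/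

import Mathlib

open MeasureTheory ProbabilityTheory Filter Topology
open scoped Distributions Nat

noncomputable section

namespace GenDensity

/-- Test functions on `ℝ^k`: `r` times continuously differentiable real functions with compact
support, with the canonical topology. -/
abbrev TestSpace (k r : ℕ) : Type :=
  𝓓^{(r : ℕ∞)}((⊤ : TopologicalSpace.Opens (Fin k → ℝ)), ℝ)

/-- Generalized functions: continuous linear functionals on the space of test functions. -/
abbrev GenFun (k r : ℕ) : Type :=
  𝓓'^{(r : ℕ∞)}((⊤ : TopologicalSpace.Opens (Fin k → ℝ)), ℝ)

/-- The partial derivative `∂g/∂x_j`. -/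
def partialDeriv {k : ℕ} (j : Fin k) (g : (Fin k → ℝ) → ℝ) : (Fin k → ℝ) → ℝ :=
  fun x => lineDeriv ℝ g x (Pi.single j 1)

/-- The mixed partial derivative `∂^{m_1 + ... + m_k} g / ∂x_1^{m_1} ... ∂x_k^{m_k}`. -/
def mixedPartial {k : ℕ} (m : Fin k → ℕ) (g : (Fin k → ℝ) → ℝ) : (Fin k → ℝ) → ℝ :=
  (List.finRange k).foldr (fun j u => (partialDeriv j)^[m j] u) g

/-- A bounded kernel of order `l` on `ℝ^k`, supported in `[-1,1]^k`. -/
structure IsKernelOfOrder {k : ℕ} (l : ℕ) (K : (Fin k → ℝ) → ℝ) : Prop where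
  integrable : Integrable K
  bounded : ∃ M : ℝ, ∀ w, |K w| ≤ M
  integral_eq_one : ∫ w, K w = 1
  support_subset : Function.support K ⊆ Set.Icc (fun _ => -1) (fun _ => 1)
  moment_eq_zero : ∀ m : Fin k → ℕ, 0 < ∑ i, m i → ∑ i, m i < l →
    ∫ w, (∏ i, w i ^ m i) * K w = 0
  moment_finite : ∀ m : Fin k → ℕ, ∑ i, m i = l →
    Integrable (fun w : Fin k → ℝ => (∏ i, w i ^ m i) * K w)

/-- The distribution function `F` of a probability measure on `ℝ^k`. -/
def distFun {k : ℕ} (μ : Measure (Fin k → ℝ)) (x : Fin k → ℝ) : ℝ :=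
  μ.real (Set.Iic x)

/-- The value `(f, ψ) = (-1)^k ∫ F ∂^kψ/∂x_1...∂x_k` of the generalized density
`f = ∂^kF/∂x_1...∂x_k`. -/
def genDensity {k : ℕ} (μ : Measure (Fin k → ℝ)) (ψ : (Fin k → ℝ) → ℝ) : ℝ :=
  (-1) ^ k * ∫ x, distFun μ x * mixedPartial (fun _ => 1) ψ x

/-- The kernel density estimator from the first `n` observations, with bandwidth vector `h`. -/
def kernelEstimator {k : ℕ} (K : (Fin k → ℝ) → ℝ) (h : Fin k → ℝ) (n : ℕ)
    (obs : ℕ → Fin k → ℝ) (x : Fin k → ℝ) : ℝ :=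
  1 / (n * ∏ j, h j) * ∑ i ∈ Finset.range n, K (fun j => (obs i j - x j) / h j)

/-- The maximal bandwidth. -/
def maxBandwidth {k : ℕ} (h : Fin k → ℝ) : ℝ := ⨆ j, h j

/-- The value at `ψ` of the leading bias functional `B(h, K)`. -/
def biasFunctional {k : ℕ} (l : ℕ) (K : (Fin k → ℝ) → ℝ) (h : Fin k → ℝ)
    (μ : Measure (Fin k → ℝ)) (ψ : (Fin k → ℝ) → ℝ) : ℝ :=
  (-1) ^ (l + k) * ∑ m ∈ Finset.piAntidiag (Finset.univ : Finset (Fin k)) l,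
    (∏ i, (h i / maxBandwidth h) ^ m i / ((m i)! : ℝ)) *
      (∫ x, distFun μ x * mixedPartial (fun i => m i + 1) ψ x) *
      ∫ w, K w * ∏ i, w i ^ m i

/-- A generalized random process: a random continuous linear functional on the test functions. -/
structure IsGenRandomProcess {k r : ℕ} {Ω : Type*} [MeasurableSpace Ω]
    (Φ : TestSpace k r → Ω → ℝ) : Prop where
  measurable : ∀ ψ, Measurable (Φ ψ)
  continuous_linear : ∀ ω, ∃ T : GenFun k r, ∀ ψ, Φ ψ ω = T ψ

/-- A generalized Gaussian process with mean functional `mean` and covariance functional `C`. -/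
structure IsGenGaussianProcess {k r : ℕ} {Ω : Type*} [MeasurableSpace Ω]
    (Z : TestSpace k r → Ω → ℝ) (P : Measure Ω) (mean : TestSpace k r → ℝ)
    (C : TestSpace k r → TestSpace k r → ℝ) : Prop where
  isGenRandomProcess : IsGenRandomProcess Z
  isGaussian : IsGaussianProcess Z P
  mean_eq : ∀ ψ, ∫ ω, Z ψ ω ∂P = mean ψ
  cov_eq : ∀ ψ₁ ψ₂, cov[Z ψ₁, Z ψ₂; P] = C ψ₁ ψ₂

/-- Convergence of generalized random processes: convergence in distribution of the random vectors
of values at any finitely many test functions. -/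
structure GenConverges {k r : ℕ} {Ω Ω' : Type*} [MeasurableSpace Ω] [MeasurableSpace Ω']
    (Φ : ℕ → TestSpace k r → Ω → ℝ) (P : Measure Ω) [IsProbabilityMeasure P]
    (Z : TestSpace k r → Ω' → ℝ) (P' : Measure Ω') [IsProbabilityMeasure P'] : Prop where
  isGenRandomProcess : ∀ n, IsGenRandomProcess (Φ n)
  isGenRandomProcess_limit : IsGenRandomProcess Z
  tendsto : ∀ (s : ℕ) (ψ : Fin s → TestSpace k r),
    TendstoInDistribution (fun n ω (i : Fin s) => Φ n (ψ i) ω) atTop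
      (fun ω (i : Fin s) => Z (ψ i) ω) (fun _ => P) P'

end GenDensity

end

/-! Integrating by parts in every coordinate turns `(f, ψ)` into `∫ ψ dμ`
(`genDensity_eq_integral`). Substituting `x = y - h w` turns `(f̂, ψ)` into the average over the
observations of the smoothed function `ψ_h(y) = ∫ K(w) ψ(y - h w) dw`
(`integral_kernelEstimator_mul`). Hence `√n (f̂ - f, ψ)` has three parts. The normalized centred sum
of `ψ(x_i)` obeys the classical central limit theorem. The centred sum for `ψ_h - ψ` has variance at
most `sup |ψ_h - ψ|²`, which tends to zero. What is left is the deterministic bias `√n ∫ (ψ_h - ψ)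
dμ` (`tendstoInDistribution_sqrt_mul_average_sub`).

For the bias, expand `ψ(x - h w)` to order `l`. The moment conditions remove the intermediate terms,
the order-`l` terms integrate to `h̄^l (B, ψ)`, and the remainder is `o(h̄^l)` uniformly in `x`,
because the derivatives of order `l` are uniformly continuous
(`IsKernelOfOrder.eventually_abs_smoothing_sub_biasTerm_le`). Since `√n h̄^l` is bounded, the error
vanishes; if `√n h̄^l → 0`, so does the term in `B`.

Values at several test functions reduce to one by linearity and Cramér–Wold
(`genConverges_of_tendstoInDistribution`).

The limit must be a random continuous functional, not just a Gaussian family. It is obtained as the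
mixed derivative of a random locally integrable function, a Gaussian series whose coefficient
functions are those of the centred indicators `1_{x ≤ y} - F(y)` in a Hilbert basis of `L²(μ)`
(`exists_gaussian_primitive`). Parseval then gives the variance `Var[ψ; μ]`. -/

namespace GenDensity

/-! ### Mixed partial derivatives: regularity, support, commutation. -/

section Calculus

variable {k : ℕ}

theorem partialDeriv_eq_fderiv {u : (Fin k → ℝ) → ℝ} (hu : Differentiable ℝ u) (j : Fin k) :
    partialDeriv j u = fun x => fderiv ℝ u x (Pi.single j 1) :=
  funext fun x => (hu x).lineDeriv_eq_fderiv

theorem contDiff_partialDeriv {n : ℕ} {u : (Fin k → ℝ) → ℝ} (hu : ContDiff ℝ (n + 1 : ℕ) u)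
    (j : Fin k) : ContDiff ℝ n (partialDeriv j u) := by
  rw [partialDeriv_eq_fderiv (hu.differentiable (by simp)) j]
  exact (hu.fderiv_right (m := n) (by norm_cast)).clm_apply contDiff_const

theorem contDiff_iterate_partialDeriv {n a : ℕ} {u : (Fin k → ℝ) → ℝ}
    (hu : ContDiff ℝ (n + a : ℕ) u) (j : Fin k) : ContDiff ℝ n ((partialDeriv j)^[a] u) := by
  induction a generalizing u with
  | zero => simpa using hu
  | succ a ih => exact ih (contDiff_partialDeriv hu j)

theorem partialDeriv_comm {u : (Fin k → ℝ) → ℝ} (hu : ContDiff ℝ 2 u) (i j : Fin k) :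
    partialDeriv i (partialDeriv j u) = partialDeriv j (partialDeriv i u) := by
  have h1 : Differentiable ℝ u := hu.differentiable (by simp)
  have h2 : Differentiable ℝ (fderiv ℝ u) :=
    (hu.fderiv_right (m := 1) (by norm_num)).differentiable (by simp)
  have key (a b : Fin k) : partialDeriv a (partialDeriv b u) =
      fun x => fderiv ℝ (fderiv ℝ u) x (Pi.single a 1) (Pi.single b 1) := by
    rw [partialDeriv_eq_fderiv h1 b, partialDeriv_eq_fderiv (h2.clm_apply (by fun_prop))]
    funext x
    rw [fderiv_clm_apply (h2 x) (by fun_prop)]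
    simp
  rw [key, key]
  funext x
  exact (hu.contDiffAt.isSymmSndFDerivAt (by simp)) _ _

theorem partialDeriv_iterate_comm {a : ℕ} {u : (Fin k → ℝ) → ℝ} (hu : ContDiff ℝ (a + 1 : ℕ) u)
    (i j : Fin k) :
    partialDeriv i ((partialDeriv j)^[a] u) = (partialDeriv j)^[a] (partialDeriv i u) := by
  induction a generalizing u with
  | zero => rfl
  | succ a ih =>
    simp only [Function.iterate_succ, Function.comp_apply]
    rw [ih (contDiff_partialDeriv hu j), partialDeriv_comm (hu.of_le _)]
    norm_cast
    omega

theorem hasCompactSupport_partialDeriv {u : (Fin k → ℝ) → ℝ} (hu : HasCompactSupport u)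
    (j : Fin k) : HasCompactSupport (partialDeriv j u) := by
  refine hu.mono' fun x hx => ?_
  by_contra hx'
  apply hx
  have h := (notMem_tsupport_iff_eventuallyEq.1 hx').lineDeriv_eq (𝕜 := ℝ) (v := Pi.single j 1)
  simpa [partialDeriv, lineDeriv] using h

/-- The partial derivatives of the directions in the list `L` with multiplicities `m`. -/
noncomputable def listPartial (L : List (Fin k)) (m : Fin k → ℕ) (u : (Fin k → ℝ) → ℝ) :
    (Fin k → ℝ) → ℝ :=
  L.foldr (fun j u => (partialDeriv j)^[m j] u) u

theorem listPartial_cons (j : Fin k) (L : List (Fin k)) (m : Fin k → ℕ) (u : (Fin k → ℝ) → ℝ) :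
    listPartial (j :: L) m u = (partialDeriv j)^[m j] (listPartial L m u) := rfl

theorem contDiff_listPartial {n : ℕ} (L : List (Fin k)) (m : Fin k → ℕ) {u : (Fin k → ℝ) → ℝ}
    (hu : ContDiff ℝ (n + (L.map m).sum : ℕ) u) : ContDiff ℝ n (listPartial L m u) := by
  induction L generalizing n with
  | nil => simpa [listPartial] using hu
  | cons j L ih =>
    rw [listPartial_cons]
    refine contDiff_iterate_partialDeriv (ih ?_) j
    simpa [add_assoc] using hu

theorem hasCompactSupport_listPartial (L : List (Fin k)) (m : Fin k → ℕ) {u : (Fin k → ℝ) → ℝ}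
    (hu : HasCompactSupport u) : HasCompactSupport (listPartial L m u) := by
  induction L with
  | nil => exact hu
  | cons j L ih =>
    rw [listPartial_cons]
    induction m j with
    | zero => exact ih
    | succ a iha =>
      rw [Function.iterate_succ_apply']
      exact hasCompactSupport_partialDeriv iha j

theorem listPartial_congr {L : List (Fin k)} {m m' : Fin k → ℕ} (h : ∀ j ∈ L, m j = m' j)
    (u : (Fin k → ℝ) → ℝ) : listPartial L m u = listPartial L m' u := by
  induction L with
  | nil => rfl
  | cons j L ih =>
    rw [listPartial_cons, listPartial_cons, h j (by simp),
      ih fun a ha => h a (List.mem_cons_of_mem _ ha)]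

theorem partialDeriv_listPartial (i : Fin k) (L : List (Fin k)) (m : Fin k → ℕ)
    {u : (Fin k → ℝ) → ℝ} (hu : ContDiff ℝ ((L.map m).sum + 1 : ℕ) u) :
    partialDeriv i (listPartial L m u) = listPartial L m (partialDeriv i u) := by
  induction L with
  | nil => rfl
  | cons j L ih =>
    simp only [List.map_cons, List.sum_cons] at hu
    rw [listPartial_cons, listPartial_cons, partialDeriv_iterate_comm, ih]
    · exact hu.of_le (by norm_cast; omega)
    · exact contDiff_listPartial L m (hu.of_le (by norm_cast; omega))

/-- The extra derivative commutes past other directions until it meets its own. Raising `m i`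
affects every occurrence of `i` in the list, hence `Nodup`. -/
theorem listPartial_partialDeriv {i : Fin k} {L : List (Fin k)} (hL : L.Nodup) (hi : i ∈ L)
    (m : Fin k → ℕ) {u : (Fin k → ℝ) → ℝ} (hu : ContDiff ℝ ((L.map m).sum + 1 : ℕ) u) :
    listPartial L m (partialDeriv i u) = listPartial L (m + Pi.single i 1) u := by
  induction L with
  | nil => simp at hi
  | cons j L ih =>
    simp only [List.map_cons, List.sum_cons] at hu
    rw [listPartial_cons, listPartial_cons]
    rw [List.nodup_cons] at hL
    by_cases hij : i = j
    · subst hij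
      rw [← partialDeriv_listPartial, ← Function.iterate_succ_apply]
      · rw [listPartial_congr (m' := m + Pi.single i 1)]
        · simp
        · intro a ha
          have : a ≠ i := fun h => hL.1 (h ▸ ha)
          simp [this]
      · exact hu.of_le (by norm_cast; omega)
    · rw [ih hL.2 (by simpa [hij] using hi) (hu.of_le (by norm_cast; omega))]
      have : j ≠ i := fun h => hij h.symm
      simp [this]

theorem mixedPartial_eq_listPartial (m : Fin k → ℕ) (u : (Fin k → ℝ) → ℝ) :
    mixedPartial m u = listPartial (List.finRange k) m u := rfl

theorem sum_map_finRange (m : Fin k → ℕ) : ((List.finRange k).map m).sum = ∑ i, m i := by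
  rw [← List.sum_ofFn, List.ofFn_eq_map]

theorem contDiff_mixedPartial {n : ℕ} (m : Fin k → ℕ) {u : (Fin k → ℝ) → ℝ}
    (hu : ContDiff ℝ (n + ∑ i, m i : ℕ) u) : ContDiff ℝ n (mixedPartial m u) :=
  contDiff_listPartial _ m (by rwa [sum_map_finRange])

theorem hasCompactSupport_mixedPartial (m : Fin k → ℕ) {u : (Fin k → ℝ) → ℝ}
    (hu : HasCompactSupport u) : HasCompactSupport (mixedPartial m u) :=
  hasCompactSupport_listPartial _ m hu

theorem mixedPartial_zero (u : (Fin k → ℝ) → ℝ) : mixedPartial 0 u = u := by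
  rw [mixedPartial_eq_listPartial]
  induction List.finRange k with
  | nil => rfl
  | cons j L ih => rw [listPartial_cons, ih]; rfl

theorem mixedPartial_partialDeriv (i : Fin k) (m : Fin k → ℕ) {u : (Fin k → ℝ) → ℝ}
    (hu : ContDiff ℝ (∑ i, m i + 1 : ℕ) u) :
    mixedPartial m (partialDeriv i u) = mixedPartial (m + Pi.single i 1) u :=
  listPartial_partialDeriv (List.nodup_finRange k) (List.mem_finRange i) m
    (by rwa [sum_map_finRange])

theorem partialDeriv_mixedPartial (i : Fin k) (m : Fin k → ℕ) {u : (Fin k → ℝ) → ℝ}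
    (hu : ContDiff ℝ (∑ i, m i + 1 : ℕ) u) :
    partialDeriv i (mixedPartial m u) = mixedPartial (m + Pi.single i 1) u := by
  rw [← mixedPartial_partialDeriv i m hu]
  exact partialDeriv_listPartial i _ m (by rwa [sum_map_finRange])

theorem mixedPartial_one_mixedPartial (m : Fin k → ℕ) {u : (Fin k → ℝ) → ℝ}
    (hu : ContDiff ℝ (∑ i, m i + k : ℕ) u) :
    mixedPartial (fun _ => 1) (mixedPartial m u) = mixedPartial (fun i => m i + 1) u := by
  -- Adding one direction at a time; the bound on the length keeps the total order within the
  -- available smoothness.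
  have key (L : List (Fin k)) (hL : L.length ≤ k) : listPartial L (fun _ => 1) (mixedPartial m u) =
      mixedPartial (m + (L.map fun i => Pi.single i 1).sum) u := by
    induction L with
    | nil => simp [listPartial]
    | cons j L ih =>
      simp only [List.length_cons] at hL
      rw [listPartial_cons, ih (by omega), Function.iterate_one, partialDeriv_mixedPartial]
      · simp only [List.map_cons, List.sum_cons]
        congr 1
        abel
      · refine hu.of_le ?_
        have : ∑ i, ((L.map fun i => (Pi.single i 1 : Fin k → ℕ)).sum) i = L.length := by
          clear ih hL
          induction L with
          | nil => simp
          | cons a L ih => simp [Finset.sum_add_distrib, ih, add_comm]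
        simp only [Pi.add_apply, Finset.sum_add_distrib, this]
        norm_cast
        omega
  rw [mixedPartial_eq_listPartial, key _ (by simp)]
  congr 1
  rw [← List.ofFn_eq_map, List.sum_ofFn]
  funext i
  simp [Finset.sum_apply, Pi.single_apply]

end Calculus

/-! ### Multivariate Taylor expansion with a remainder for `C^l` functions. -/

section Taylor

variable {k : ℕ}

/-- The homogeneous part of degree `j` of the Taylor expansion of `u` at `x`, evaluated at `v`. -/
noncomputable def taylorTerm (j : ℕ) (v : Fin k → ℝ) (u : (Fin k → ℝ) → ℝ) (x : Fin k → ℝ) : ℝ :=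
  ∑ m ∈ Finset.piAntidiag (Finset.univ : Finset (Fin k)) j,
    (∏ i, v i ^ m i / ((m i)! : ℝ)) * mixedPartial m u x

theorem taylorTerm_zero (v : Fin k → ℝ) (u : (Fin k → ℝ) → ℝ) (x : Fin k → ℝ) :
    taylorTerm 0 v u x = u x := by
  simp [taylorTerm, mixedPartial_zero]

theorem add_one_mul_prod_pow_div_factorial (v : Fin k → ℝ) (m : Fin k → ℕ) (i : Fin k) :
    ((m i + 1 : ℕ) : ℝ) * ∏ a, v a ^ (m + Pi.single i 1 : Fin k → ℕ) a /
      (((m + Pi.single i 1 : Fin k → ℕ) a)! : ℝ) =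
      v i * ∏ a, v a ^ m a / ((m a)! : ℝ) := by
  rw [← Finset.mul_prod_erase _ _ (Finset.mem_univ i),
    ← Finset.mul_prod_erase Finset.univ (fun a => v a ^ m a / ((m a)! : ℝ)) (Finset.mem_univ i)]
  have : ∏ a ∈ Finset.univ.erase i, v a ^ (m + Pi.single i 1 : Fin k → ℕ) a /
      (((m + Pi.single i 1 : Fin k → ℕ) a)! : ℝ)
      = ∏ a ∈ Finset.univ.erase i, v a ^ m a / ((m a)! : ℝ) :=
    Finset.prod_congr rfl fun a ha => by simp [Finset.ne_of_mem_erase ha]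
  rw [this]
  simp only [Pi.add_apply, Pi.single_eq_same, Nat.factorial_succ]
  push_cast
  have h1 : ((m i)! : ℝ) ≠ 0 := by positivity
  have h2 : (m i : ℝ) + 1 ≠ 0 := by positivity
  field_simp
  ring

/-- The combinatorial form of `(v · ∇) T_j = (j + 1) T_{j+1}`: an index `m` of degree `j + 1` arises
by raising coordinate `i` with weight `m i`, and these weights add up to `j + 1`. -/
theorem sum_piAntidiag_succ (j : ℕ) (v : Fin k → ℝ) (g : (Fin k → ℕ) → ℝ) :
    ∑ m ∈ Finset.piAntidiag (Finset.univ : Finset (Fin k)) j,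
      (∏ i, v i ^ m i / ((m i)! : ℝ)) * ∑ i, v i * g (m + Pi.single i 1) =
    (j + 1) * ∑ m ∈ Finset.piAntidiag (Finset.univ : Finset (Fin k)) (j + 1),
      (∏ i, v i ^ m i / ((m i)! : ℝ)) * g m := by
  have key (i : Fin k) : ∑ m ∈ Finset.piAntidiag (Finset.univ : Finset (Fin k)) j,
      (∏ i, v i ^ m i / ((m i)! : ℝ)) * (v i * g (m + Pi.single i 1)) =
      ∑ m ∈ Finset.piAntidiag (Finset.univ : Finset (Fin k)) (j + 1),
        (m i : ℝ) * ((∏ i, v i ^ m i / ((m i)! : ℝ)) * g m) := by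
    have hle (m : Fin k → ℕ) (hm : m i ≠ 0) : Pi.single i 1 ≤ m := by
      intro a
      rcases eq_or_ne a i with rfl | ha
      · simpa using Nat.one_le_iff_ne_zero.2 hm
      · simp [ha]
    symm
    -- Indices with `m i = 0` carry weight zero; the others are exactly the shifts of indices of
    -- degree `j`.
    rw [← Finset.sum_filter_of_ne (p := fun m : Fin k → ℕ => m i ≠ 0)]
    · refine Finset.sum_nbij' (fun m => m - Pi.single i 1) (fun m => m + Pi.single i 1) ?_ ?_ ?_ ?_ ?_
      · intro m hm
        simp only [Finset.mem_piAntidiag, Finset.mem_filter] at hm ⊢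
        have : ∑ a, ((m - Pi.single i 1) + Pi.single i 1 : Fin k → ℕ) a = j + 1 := by
          rw [tsub_add_cancel_of_le (hle m hm.2), hm.1.1]
        simp [Finset.sum_add_distrib] at this
        simpa using this
      · intro m hm
        simp only [Finset.mem_piAntidiag, Finset.mem_filter] at hm ⊢
        simp [Finset.sum_add_distrib, hm.1]
      · intro m hm
        exact tsub_add_cancel_of_le (hle m (Finset.mem_filter.1 hm).2)
      · intro m _
        simp
      · intro m hm
        obtain ⟨m', rfl⟩ : ∃ m', m = m' + Pi.single i 1 :=
          ⟨m - Pi.single i 1, (tsub_add_cancel_of_le (hle m (Finset.mem_filter.1 hm).2)).symm⟩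
        have := add_one_mul_prod_pow_div_factorial v m' i
        rw [add_tsub_cancel_right, ← mul_assoc, ← mul_assoc, mul_comm _ (v i), ← this]
        simp
    · intro m _ h h0
      simp [h0] at h
  simp_rw [Finset.mul_sum]
  rw [Finset.sum_comm]
  simp_rw [key]
  rw [Finset.sum_comm]
  refine Finset.sum_congr rfl fun m hm => ?_
  rw [← Finset.sum_mul]
  congr 1
  exact_mod_cast (Finset.mem_piAntidiag.1 hm).1

theorem hasDerivAt_taylorTerm {j : ℕ} {u : (Fin k → ℝ) → ℝ} (hu : ContDiff ℝ (j + 1 : ℕ) u)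
    (x v : Fin k → ℝ) (t : ℝ) :
    HasDerivAt (fun t : ℝ => taylorTerm j v u (x + t • v))
      ((j + 1) * taylorTerm (j + 1) v u (x + t • v)) t := by
  rw [taylorTerm, ← sum_piAntidiag_succ j v (fun m => mixedPartial m u (x + t • v))]
  refine HasDerivAt.fun_sum fun m hm => HasDerivAt.const_mul _ ?_
  have hm' : ∑ i, m i = j := (Finset.mem_piAntidiag.1 hm).1
  have hd : Differentiable ℝ (mixedPartial m u) :=
    (contDiff_mixedPartial (n := 1) m (by rw [hm', add_comm]; exact hu)).differentiable (by simp)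
  have hline : HasDerivAt (fun t : ℝ => x + t • v) v t := by
    simpa using ((hasDerivAt_id t).smul_const v).const_add x
  have h := (hd (x + t • v)).hasFDerivAt.comp_hasDerivAt t hline
  convert! h using 1
  have hsum (A : (Fin k → ℝ) →L[ℝ] ℝ) : A v = ∑ i, v i * A (Pi.single i 1) := by
    conv_lhs => rw [pi_eq_sum_univ' v]
    simp
  rw [hsum]
  refine Finset.sum_congr rfl fun i _ => ?_
  rw [← partialDeriv_mixedPartial i m (by rw [hm']; exact hu), partialDeriv_eq_fderiv hd]

/-- Differentiating `(1 - t)^j` in one term cancels the derivative of the Taylor term before it, so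
the sum telescopes and only the top order survives. -/
theorem hasDerivAt_sum_taylorTerm {l : ℕ} {u : (Fin k → ℝ) → ℝ} (hu : ContDiff ℝ (l + 1 : ℕ) u)
    (x v : Fin k → ℝ) (t : ℝ) :
    HasDerivAt (fun t : ℝ => ∑ j ∈ Finset.range (l + 1), (1 - t) ^ j * taylorTerm j v u (x + t • v))
      ((l + 1) * (1 - t) ^ l * taylorTerm (l + 1) v u (x + t • v)) t := by
  induction l with
  | zero => simpa using hasDerivAt_taylorTerm hu x v t
  | succ l ih =>
    have h1 := ih (hu.of_le (by norm_cast; omega))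
    have h2 : HasDerivAt (fun t : ℝ => (1 - t) ^ (l + 1)) (((l + 1 : ℕ) : ℝ) * (1 - t) ^ l * (-1)) t := by
      simpa using ((hasDerivAt_id t).const_sub 1).fun_pow (l + 1)
    have h3 := h1.add (h2.mul (hasDerivAt_taylorTerm hu x v t))
    simp_rw [Finset.sum_range_succ _ (l + 1)]
    convert! h3 using 1
    push_cast
    ring

/-- Mean value inequality for a path from the Taylor polynomial at `t = 0` to `u (x + v)` at `t =
1`. Freezing the top-order term at `x` is what makes `C^l`, rather than `C^{l+1}`, sufficient. -/
theorem abs_sub_sum_taylorTerm_le {l : ℕ} (hl : 0 < l) {u : (Fin k → ℝ) → ℝ} (hu : ContDiff ℝ l u)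
    (x v : Fin k → ℝ) {b ε : ℝ} (hb : ∀ i, |v i| ≤ b)
    (hε : ∀ m : Fin k → ℕ, ∑ i, m i = l → ∀ t ∈ Set.Icc (0 : ℝ) 1,
      |mixedPartial m u (x + t • v) - mixedPartial m u x| ≤ ε) :
    |u (x + v) - ∑ j ∈ Finset.range (l + 1), taylorTerm j v u x| ≤
      l * ((Finset.piAntidiag (Finset.univ : Finset (Fin k)) l).card * (b ^ l * ε)) := by
  obtain ⟨l, rfl⟩ : ∃ l', l = l' + 1 := ⟨l - 1, by omega⟩
  have hd (t : ℝ) : |taylorTerm (l + 1) v u (x + t • v) - taylorTerm (l + 1) v u x| ≤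
      (Finset.piAntidiag (Finset.univ : Finset (Fin k)) (l + 1)).card * (b ^ (l + 1) * ε) ∨
      t ∉ Set.Icc (0 : ℝ) 1 := by
    by_cases ht : t ∈ Set.Icc (0 : ℝ) 1
    · left
      rw [taylorTerm, taylorTerm, ← Finset.sum_sub_distrib, ← nsmul_eq_mul]
      refine (Finset.abs_sum_le_sum_abs _ _).trans (Finset.sum_le_card_nsmul _ _ _ fun m hm => ?_)
      have hm' : ∑ i, m i = l + 1 := (Finset.mem_piAntidiag.1 hm).1
      rw [← mul_sub, abs_mul]
      refine mul_le_mul ?_ (hε m hm' t ht) (abs_nonneg _) ?_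
      · rw [Finset.abs_prod, ← hm', ← Finset.prod_pow_eq_pow_sum]
        refine Finset.prod_le_prod (fun i _ => abs_nonneg _) fun i _ => ?_
        rw [abs_div, abs_pow, Nat.abs_cast]
        have h1 : (1 : ℝ) ≤ ((m i)! : ℝ) := by exact_mod_cast (Nat.factorial_pos _)
        calc |v i| ^ m i / ((m i)! : ℝ) ≤ |v i| ^ m i := div_le_self (by positivity) h1
          _ ≤ b ^ m i := pow_le_pow_left₀ (abs_nonneg _) (hb i) _
      -- That `b` is nonnegative needs a coordinate; for `k = 0` no multi-index has positive degree.
      · rcases Nat.eq_zero_or_pos k with rfl | hk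
        · simp at hm'
        · exact pow_nonneg ((abs_nonneg _).trans (hb ⟨0, hk⟩)) _
    · exact Or.inr ht
  set C := (Finset.piAntidiag (Finset.univ : Finset (Fin k)) (l + 1)).card * (b ^ (l + 1) * ε)
  set T := taylorTerm (l + 1) v u x with hT
  have hder (t : ℝ) : HasDerivAt (fun t : ℝ => (∑ j ∈ Finset.range (l + 1),
      (1 - t) ^ j * taylorTerm j v u (x + t • v)) + (1 - t) ^ (l + 1) * T)
      ((l + 1) * (1 - t) ^ l * (taylorTerm (l + 1) v u (x + t • v) - T)) t := by
    have h2 : HasDerivAt (fun t : ℝ => (1 - t) ^ (l + 1)) (((l + 1 : ℕ) : ℝ) * (1 - t) ^ l * (-1)) t := by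
      simpa using ((hasDerivAt_id t).const_sub 1).fun_pow (l + 1)
    convert! (hasDerivAt_sum_taylorTerm hu x v t).add (h2.mul_const T) using 1
    push_cast
    ring
  have := norm_image_sub_le_of_norm_deriv_le_segment_01' (C := ((l + 1 : ℕ) : ℝ) * C)
    (fun t _ => (hder t).hasDerivWithinAt) fun t ht => ?_
  · simp only [Real.norm_eq_abs] at this
    convert this using 2
    rw [Finset.sum_range_succ, Finset.sum_range_succ']
    simp [taylorTerm_zero, Finset.sum_range_succ', hT]
  · have ht' : t ∈ Set.Icc (0 : ℝ) 1 := Set.Ico_subset_Icc_self ht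
    have h1 := (hd t).resolve_right (not_not.2 ht')
    rw [Real.norm_eq_abs, abs_mul, abs_mul]
    have h3 : |(1 - t) ^ l| ≤ 1 := by
      rw [abs_pow]
      refine pow_le_one₀ (abs_nonneg _) (abs_le.2 ⟨by linarith [ht'.2], by linarith [ht'.1]⟩)
    have h4 : |(l : ℝ) + 1| = ((l + 1 : ℕ) : ℝ) := by
      push_cast
      exact abs_of_nonneg (by positivity)
    rw [h4]
    calc _ ≤ ((l + 1 : ℕ) : ℝ) * 1 * C := by gcongr
      _ = _ := by ring

end Taylor

/-! ### Integration of the full mixed derivative over an orthant. -/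

section IntegrationByParts

theorem partialDeriv_zero_cons {k : ℕ} (v : (Fin (k + 1) → ℝ) → ℝ) (s : ℝ) (y : Fin k → ℝ) :
    partialDeriv 0 v (Fin.cons s y) = deriv (fun t => v (Fin.cons t y : Fin (k + 1) → ℝ)) s := by
  have (t : ℝ) : (Fin.cons s y : Fin (k + 1) → ℝ) + t • Pi.single 0 1 = Fin.cons (s + t) y := by
    ext i
    refine Fin.cases ?_ (fun i => ?_) i <;> simp
  rw [partialDeriv, lineDeriv]
  simp_rw [this]
  simpa using deriv_comp_const_add (fun t => v (Fin.cons t y : Fin (k + 1) → ℝ)) s 0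

theorem partialDeriv_succ_cons {k : ℕ} (v : (Fin (k + 1) → ℝ) → ℝ) (s : ℝ) (j : Fin k) :
    (fun y : Fin k → ℝ => partialDeriv j.succ v (Fin.cons s y)) =
      partialDeriv j fun y => v (Fin.cons s y) := by
  funext y
  have (t : ℝ) : (Fin.cons s y : Fin (k + 1) → ℝ) + t • Pi.single j.succ 1 =
      (Fin.cons s (y + t • Pi.single j 1 : Fin k → ℝ) : Fin (k + 1) → ℝ) := by
    ext i
    refine Fin.cases ?_ (fun i => ?_) i
    · simp
    · simp [Pi.single_apply]
  simp [partialDeriv, lineDeriv, this]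

theorem listPartial_map_succ_cons {k : ℕ} (L : List (Fin k)) (v : (Fin (k + 1) → ℝ) → ℝ) (s : ℝ) :
    (fun y : Fin k → ℝ => listPartial (L.map Fin.succ) (fun _ => 1) v (Fin.cons s y)) =
      listPartial L (fun _ => 1) fun y => v (Fin.cons s y) := by
  induction L with
  | nil => rfl
  | cons j L ih =>
    rw [List.map_cons, listPartial_cons, listPartial_cons, Function.iterate_one,
      Function.iterate_one, partialDeriv_succ_cons, ih]

theorem contDiff_cons_left {k : ℕ} {n : ℕ} (y : Fin k → ℝ) :
    ContDiff ℝ n fun t : ℝ => (Fin.cons t y : Fin (k + 1) → ℝ) := by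
  refine contDiff_pi.2 fun i => ?_
  refine Fin.cases ?_ (fun i => ?_) i <;> simp <;> fun_prop

theorem contDiff_cons_right {k : ℕ} {n : ℕ} (s : ℝ) :
    ContDiff ℝ n fun y : Fin k → ℝ => (Fin.cons s y : Fin (k + 1) → ℝ) := by
  refine contDiff_pi.2 fun i => ?_
  refine Fin.cases ?_ (fun i => ?_) i <;> simp <;> fun_prop

theorem hasCompactSupport_comp_cons_left {k : ℕ} {v : (Fin (k + 1) → ℝ) → ℝ}
    (hv : HasCompactSupport v) (y : Fin k → ℝ) :
    HasCompactSupport fun t : ℝ => v (Fin.cons t y : Fin (k + 1) → ℝ) := by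
  refine HasCompactSupport.of_support_subset_isCompact
    (hv.isCompact.image (continuous_apply (0 : Fin (k + 1)))) fun t ht => ?_
  exact ⟨_, subset_tsupport _ ht, by simp⟩

theorem hasCompactSupport_comp_cons_right {k : ℕ} {v : (Fin (k + 1) → ℝ) → ℝ}
    (hv : HasCompactSupport v) (s : ℝ) :
    HasCompactSupport fun y : Fin k → ℝ => v (Fin.cons s y : Fin (k + 1) → ℝ) := by
  have hc : Continuous fun z : Fin (k + 1) → ℝ => (Fin.tail z : Fin k → ℝ) :=
    continuous_pi fun i => continuous_apply i.succ
  refine HasCompactSupport.of_support_subset_isCompact (hv.isCompact.image hc) fun t ht => ?_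
  exact ⟨_, subset_tsupport _ ht, by simp⟩

/-- Induction on dimension: integrating `∂/∂x_0` over a half-line gives minus the boundary value, by
compact support, and on that slice the remaining derivatives form the mixed derivative in one
variable fewer. -/
theorem setIntegral_Ici_mixedPartial_one {k : ℕ} {u : (Fin k → ℝ) → ℝ} (hu : ContDiff ℝ k u)
    (hc : HasCompactSupport u) (x : Fin k → ℝ) :
    ∫ y in Set.Ici x, mixedPartial (fun _ => 1) u y = (-1) ^ k * u x := by
  induction k with
  | zero =>
    have h1 : Set.Ici x = Set.univ := by
      ext y
      simp [Subsingleton.elim y x]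
    have h2 : mixedPartial (fun _ => 1) u = u := rfl
    rw [h1, h2, setIntegral_univ, Measure.volume_pi_eq_dirac x, integral_dirac]
    simp
  | succ k ih =>
    obtain ⟨x0, x', rfl⟩ : ∃ (x0 : ℝ) (x' : Fin k → ℝ), x = Fin.cons x0 x' :=
      ⟨x 0, Fin.tail x, (Fin.cons_self_tail x).symm⟩
    set v := listPartial ((List.finRange k).map Fin.succ) (fun _ => 1) u with hv
    have hmix : mixedPartial (fun _ => 1) u = partialDeriv 0 v := by
      rw [mixedPartial_eq_listPartial, List.finRange_succ, listPartial_cons, Function.iterate_one]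
    have hv1 : ContDiff ℝ (1 : ℕ) v :=
      contDiff_listPartial _ _ (by simpa [Function.comp_def, add_comm] using hu)
    have hvc : HasCompactSupport v := hasCompactSupport_listPartial _ _ hc
    have hpc : Continuous (partialDeriv 0 v) := (contDiff_partialDeriv (n := 0) hv1 0).continuous
    have hint : Integrable (partialDeriv 0 v) :=
      hpc.integrable_of_hasCompactSupport (hasCompactSupport_partialDeriv hvc 0)
    let e := MeasurableEquiv.piFinSuccAbove (fun _ : Fin (k + 1) => ℝ) 0
    have he : MeasurePreserving e.symm := (volume_preserving_piFinSuccAbove (fun _ => ℝ) 0).symm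
    have hes (p : ℝ × (Fin k → ℝ)) : e.symm p = Fin.cons p.1 p.2 := by
      simp [e, MeasurableEquiv.piFinSuccAbove, Fin.consEquiv]
    have hpre : e.symm ⁻¹' Set.Ici (Fin.cons x0 x') = Set.Ici x0 ×ˢ Set.Ici x' := by
      ext p
      simp [hes, Pi.le_def, Prod.le_def, Fin.forall_fin_succ]
    -- The swap makes coordinate `0` the inner integration variable.
    rw [hmix, ← he.setIntegral_preimage_emb e.symm.measurableEmbedding, hpre,
      Measure.volume_eq_prod, ← setIntegral_prod_swap, setIntegral_prod]
    · simp only [Prod.swap_prod_mk, hes, partialDeriv_zero_cons]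
      have hin (y : Fin k → ℝ) :
          ∫ s in Set.Ici x0, deriv (fun t => v (Fin.cons t y : Fin (k + 1) → ℝ)) s =
            - v (Fin.cons x0 y) := by
        rw [integral_Ici_eq_integral_Ioi]
        exact HasCompactSupport.integral_Ioi_deriv_eq
          (f := fun t => v (Fin.cons t y : Fin (k + 1) → ℝ))
          (hv1.comp (contDiff_cons_left y)) (hasCompactSupport_comp_cons_left hvc y) x0
      simp_rw [hin]
      rw [integral_neg, hv, listPartial_map_succ_cons, ← mixedPartial_eq_listPartial, ih]
      · ring
      · exact (hu.of_le (by norm_cast; omega)).comp (contDiff_cons_right x0)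
      · exact hasCompactSupport_comp_cons_right hc x0
    · refine Integrable.integrableOn ?_
      have := (he.integrable_comp_emb e.symm.measurableEmbedding).2 hint
      rw [Measure.volume_eq_prod] at this
      exact this.swap

end IntegrationByParts

/-! ### Gaussian series with values in a Hilbert space. -/

section GaussianSeries

open scoped RealInnerProductSpace ENNReal

theorem norm_exp_mul_I_sub_exp_mul_I_le (a b : ℝ) :
    ‖Complex.exp (a * Complex.I) - Complex.exp (b * Complex.I)‖ ≤ |a - b| := by
  have h : Complex.exp (a * Complex.I) - Complex.exp (b * Complex.I) =
      Complex.exp (b * Complex.I) * (Complex.exp (Complex.I * ((a - b : ℝ) : ℂ)) - 1) := by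
    rw [mul_sub, ← Complex.exp_add]
    push_cast
    ring_nf
  rw [h, norm_mul, Complex.norm_exp_ofReal_mul_I, one_mul]
  exact Real.norm_exp_I_mul_ofReal_sub_one_le

theorem integral_abs_le_norm_Lp {Ω : Type*} [MeasurableSpace Ω] {P : Measure Ω}
    [IsProbabilityMeasure P] (f : Lp ℝ 2 P) : ∫ ω, |f ω| ∂P ≤ ‖f‖ := by
  have h := eLpNorm_le_eLpNorm_of_exponent_le (p := 1) (q := 2) (by norm_num)
    (Lp.aestronglyMeasurable f)
  have h2 := ENNReal.toReal_mono (Lp.eLpNorm_ne_top f) h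
  rw [Lp.norm_def]
  refine le_trans (le_of_eq ?_) h2
  rw [eLpNorm_one_eq_lintegral_enorm, ← integral_norm_eq_lintegral_enorm (Lp.aestronglyMeasurable f)]
  rfl

/-- `a ↦ exp (i a)` is 1-Lipschitz and the `L¹` norm is at most the `L²` norm. -/
theorem tendsto_charFun_of_tendsto_Lp {Ω β : Type*} [MeasurableSpace Ω] {P : Measure Ω}
    [IsProbabilityMeasure P] {l : Filter β} {f : β → Lp ℝ 2 P} {g : Lp ℝ 2 P}
    (h : Tendsto f l (𝓝 g)) (t : ℝ) :
    Tendsto (fun s => charFun (P.map (f s)) t) l (𝓝 (charFun (P.map g) t)) := by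
  have hchar (f : Lp ℝ 2 P) : charFun (P.map f) t = ∫ ω, Complex.exp ((t * f ω : ℝ) * Complex.I) ∂P := by
    rw [charFun_apply_real, integral_map (Lp.aestronglyMeasurable f).aemeasurable]
    · simp
    · fun_prop
  have hint (f : Lp ℝ 2 P) : Integrable (fun ω => Complex.exp ((t * f ω : ℝ) * Complex.I)) P := by
    refine Integrable.of_bound (C := 1) ?_ (ae_of_all _ fun ω => by
      rw [Complex.norm_exp_ofReal_mul_I])
    have := Lp.aestronglyMeasurable f
    fun_prop
  rw [tendsto_iff_norm_sub_tendsto_zero]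
  have h0 : Tendsto (fun s => |t| * ‖f s - g‖) l (𝓝 0) := by
    simpa using (tendsto_iff_norm_sub_tendsto_zero.1 h).const_mul |t|
  refine squeeze_zero (fun _ => norm_nonneg _) (fun s => ?_) h0
  rw [hchar, hchar, ← integral_sub (hint _) (hint _)]
  calc _ ≤ ∫ ω, |t| * |(f s - g : Lp ℝ 2 P) ω| ∂P := by
        refine norm_integral_le_of_norm_le ?_ ?_
        · exact ((Lp.memLp (f s - g)).integrable one_le_two).abs.const_mul _
        · filter_upwards [Lp.coeFn_sub (f s) g] with ω hω
          rw [hω]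
          refine (norm_exp_mul_I_sub_exp_mul_I_le _ _).trans_eq ?_
          rw [← mul_sub, abs_mul, Pi.sub_apply]
    _ ≤ _ := by
        rw [integral_const_mul]
        gcongr
        exact integral_abs_le_norm_Lp _

variable {Ω ι H : Type*} [MeasurableSpace Ω] {P : Measure Ω} [NormedAddCommGroup H]
  [InnerProductSpace ℝ H]

theorem memLp_smul_const {ξ : Ω → ℝ} (hξ : MemLp ξ 2 P) (x : H) :
    MemLp (fun ω => ξ ω • x) 2 P :=
  MemLp.of_le_mul (c := ‖x‖) hξ (hξ.1.smul_const x) (ae_of_all _ fun ω => by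
    rw [norm_smul, mul_comm])

/-- Uncorrelated centred scalars thus give orthogonal copies of `H` in `L²(P; H)`. -/
theorem inner_toLp_smul_const {ξ η : Ω → ℝ} (hξ : MemLp ξ 2 P) (hη : MemLp η 2 P) (x y : H) :
    ⟪(memLp_smul_const hξ x).toLp, (memLp_smul_const hη y).toLp⟫ = (∫ ω, ξ ω * η ω ∂P) * ⟪x, y⟫ := by
  rw [L2.inner_def, ← integral_mul_const]
  refine integral_congr_ae ?_
  filter_upwards [(memLp_smul_const hξ x).coeFn_toLp, (memLp_smul_const hη y).coeFn_toLp]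
    with ω h1 h2
  rw [h1, h2, real_inner_smul_left, real_inner_smul_right, mul_assoc]

/-- Multiplication by a normalized random variable, as an isometry into `L²`. -/
noncomputable def smulIsometry {ξ : Ω → ℝ} (hξ : MemLp ξ 2 P) (h1 : ∫ ω, ξ ω * ξ ω ∂P = 1) :
    H →ₗᵢ[ℝ] Lp H 2 P where
  toFun x := (memLp_smul_const hξ x).toLp
  map_add' x y := by
    rw [← MemLp.toLp_add]
    congr 1
    ext ω
    simp
  map_smul' c x := by
    rw [RingHom.id_apply, ← MemLp.toLp_const_smul]
    congr 1
    ext ω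
    simp [smul_comm c]
  norm_map' x := by
    have h := inner_toLp_smul_const hξ hξ x x
    rw [h1, one_mul, real_inner_self_eq_norm_sq, real_inner_self_eq_norm_sq] at h
    exact (sq_eq_sq₀ (norm_nonneg _) (norm_nonneg _)).1 h

theorem smulIsometry_apply {ξ : Ω → ℝ} (hξ : MemLp ξ 2 P) (h1 : ∫ ω, ξ ω * ξ ω ∂P = 1) (x : H) :
    smulIsometry hξ h1 x = (memLp_smul_const hξ x).toLp := rfl

/-- For independent standard Gaussian variables `ξ i` and square summable vectors `a i`, there is
a random vector `∑ i, ξ i • a i`; its scalar products with fixed vectors are Gaussian. -/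
theorem exists_random_vector_hasLaw_inner [CompleteSpace H] [IsProbabilityMeasure P] {ξ : ι → Ω → ℝ}
    (hξ : ∀ i, HasLaw (ξ i) (gaussianReal 0 1) P) (hind : iIndepFun ξ P) {a : ι → H}
    (ha : Summable fun i => ‖a i‖ ^ 2) :
    ∃ G : Ω → H, StronglyMeasurable G ∧ ∀ h : H,
      HasLaw (fun ω => ⟪h, G ω⟫) (gaussianReal 0 (∑' i, ⟪h, a i⟫ ^ 2).toNNReal) P := by
  have hmem (i : ι) : MemLp (ξ i) 2 P := by
    have := memLp_id_gaussianReal' (μ := 0) (v := 1) 2 (by simp)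
    rw [← (hξ i).map_eq] at this
    exact (memLp_map_measure_iff this.1 (hξ i).aemeasurable).1 this
  have hmean (i : ι) : ∫ ω, ξ i ω ∂P = 0 := by
    have := integral_id_gaussianReal (μ := 0) (v := 1)
    rwa [← (hξ i).map_eq, integral_map (hξ i).aemeasurable (by fun_prop)] at this
  have hsq (i : ι) : ∫ ω, ξ i ω * ξ i ω ∂P = 1 := by
    have := variance_id_gaussianReal (μ := 0) (v := 1)
    rw [← (hξ i).map_eq, variance_map (by fun_prop) (hξ i).aemeasurable,
      variance_of_integral_eq_zero] at this
    · simpa [pow_two] using this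
    · exact (hξ i).aemeasurable
    · simpa using hmean i
  have hmul {i j : ι} (hij : i ≠ j) : ∫ ω, ξ i ω * ξ j ω ∂P = 0 := by
    rw [(hind.indepFun hij).integral_fun_mul_eq_mul_integral (hmem i).1 (hmem j).1, hmean, zero_mul]
  have hort : OrthogonalFamily ℝ (fun _ : ι => H) fun i => smulIsometry (H := H) (hmem i) (hsq i) := by
    intro i j hij x y
    rw [smulIsometry_apply, smulIsometry_apply, inner_toLp_smul_const (hmem i) (hmem j), hmul hij,
      zero_mul]
  -- In an orthogonal family square summability of the norms is convergence, so the series has a sum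
  -- in `L²(P; H)`.
  obtain ⟨G, hG⟩ := (hort.summable_iff_norm_sq_summable a).2 ha
  refine ⟨G, Lp.stronglyMeasurable G, fun h => ?_⟩
  have hGm : AEMeasurable (fun ω => ⟪h, G ω⟫) P :=
    ((continuous_const.inner continuous_id).comp_stronglyMeasurable
      (Lp.stronglyMeasurable G)).measurable.aemeasurable
  refine ⟨hGm, ?_⟩
  set c : ι → ℝ := fun i => ⟪h, a i⟫ with hc
  have hcs : Summable fun i => c i ^ 2 := by
    refine Summable.of_nonneg_of_le (fun _ => sq_nonneg _) (fun i => ?_) (ha.mul_left (‖h‖ ^ 2))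
    rw [← mul_pow, ← sq_abs]
    gcongr
    exact abs_real_inner_le_norm h (a i)
  have hΛ := ((innerSL ℝ h).compLpL 2 P).hasSum hG
  have hpart (s : Finset ι) : (∑ i ∈ s, (innerSL ℝ h).compLpL 2 P (smulIsometry (hmem i) (hsq i) (a i)) :
      Lp ℝ 2 P) =ᵐ[P] fun ω => ∑ i ∈ s, c i * ξ i ω := by
    have h1 := Lp.coeFn_fun_finsetSum s fun i =>
      (innerSL ℝ h).compLpL 2 P (smulIsometry (hmem i) (hsq i) (a i))
    have h2 : ∀ᵐ ω ∂P, ∀ i ∈ s, (innerSL ℝ h).compLpL 2 P (smulIsometry (hmem i) (hsq i) (a i)) ω =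
        c i * ξ i ω := by
      rw [eventually_all_finset]
      intro i _
      filter_upwards [ContinuousLinearMap.coeFn_compLpL (innerSL ℝ h)
        (smulIsometry (hmem i) (hsq i) (a i)), (memLp_smul_const (hmem i) (a i)).coeFn_toLp]
        with ω h1 h2
      rw [h1, smulIsometry_apply, h2]
      simp [hc, mul_comm]
    filter_upwards [h1, h2] with ω h1 h2
    rw [h1]
    exact Finset.sum_congr rfl h2
  have hlim : ((innerSL ℝ h).compLpL 2 P G : Lp ℝ 2 P) =ᵐ[P] fun ω => ⟪h, G ω⟫ := by
    filter_upwards [ContinuousLinearMap.coeFn_compLpL (innerSL ℝ h) G] with ω h1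
    rw [h1]
    rfl
  rw [← Measure.map_congr hlim]
  have : IsProbabilityMeasure (P.map ((innerSL ℝ h).compLpL 2 P G : Lp ℝ 2 P)) :=
    Measure.isProbabilityMeasure_map (Lp.aestronglyMeasurable _).aemeasurable
  refine Measure.ext_of_charFun (funext fun t => ?_)
  -- The characteristic functions of the partial sums are explicit by independence; their limit is
  -- the Gaussian one.
  refine tendsto_nhds_unique (tendsto_charFun_of_tendsto_Lp hΛ t) ?_
  have hval (s : Finset ι) : charFun (P.map (∑ i ∈ s, (innerSL ℝ h).compLpL 2 P
      (smulIsometry (hmem i) (hsq i) (a i)) : Lp ℝ 2 P)) t =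
      Complex.exp ((-(t ^ 2 * (∑ i ∈ s, c i ^ 2) / 2) : ℝ)) := by
    rw [Measure.map_congr (hpart s), iIndepFun.charFun_map_fun_finsetSum_eq_prod
      (X := fun i ω => c i * ξ i ω) (fun i _ => (hξ i).aemeasurable.const_mul _)]
    · simp only [Finset.prod_apply, charFun_map_mul_comp (hξ _).aemeasurable, (hξ _).map_eq,
        charFun_gaussianReal]
      rw [← Complex.exp_sum]
      congr 1
      push_cast
      rw [Finset.mul_sum, Finset.sum_div, ← Finset.sum_neg_distrib]
      refine Finset.sum_congr rfl fun i _ => ?_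
      simp
      ring
    · exact (hind.comp (fun i x => c i * x) (fun i => by fun_prop)).restrict _
  simp_rw [hval]
  rw [charFun_gaussianReal]
  have h3 : Complex.exp (t * (0 : ℝ) * Complex.I - ((∑' i, c i ^ 2).toNNReal : ℝ) * t ^ 2 / 2) =
      Complex.exp ((-(t ^ 2 * (∑' i, c i ^ 2) / 2) : ℝ)) := by
    rw [Real.coe_toNNReal _ (tsum_nonneg fun _ => sq_nonneg _)]
    congr 1
    push_cast
    ring
  rw [h3]
  have h4 : Tendsto (fun s : Finset ι => -(t ^ 2 * (∑ i ∈ s, c i ^ 2) / 2)) atTop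
      (𝓝 (-(t ^ 2 * (∑' i, c i ^ 2) / 2))) :=
    ((hcs.hasSum.const_mul (t ^ 2)).div_const 2).neg
  exact ((Complex.continuous_exp.comp Complex.continuous_ofReal).tendsto _).comp h4

end GaussianSeries

/-! ### Integrals against the distribution function as integrals against `μ`. -/

section DistributionFunction

variable {k : ℕ} (μ : Measure (Fin k → ℝ)) [IsProbabilityMeasure μ]

theorem measurableSet_setOf_le : MeasurableSet {p : (Fin k → ℝ) × (Fin k → ℝ) | p.2 ≤ p.1} :=
  (isClosed_le continuous_snd continuous_fst).measurableSet

theorem stronglyMeasurable_setIntegral_Iic {e : (Fin k → ℝ) → ℝ} (he : StronglyMeasurable e) :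
    StronglyMeasurable fun y => ∫ x in Set.Iic y, e x ∂μ := by
  have h : StronglyMeasurable (Function.uncurry fun (y x : Fin k → ℝ) =>
      (Set.Iic y).indicator e x) :=
    (he.comp_measurable measurable_snd).indicator (measurableSet_setOf_le (k := k))
  simpa only [integral_indicator measurableSet_Iic] using h.integral_prod_right (ν := μ)

/-- By Fubini the constraint `x ≤ y` becomes integration of the mixed derivative over `y ∈ Ici x`.
Taking `e = 1` yields the generalized density; taking `e` a centred basis vector yields the
coefficients of the limit process. -/
theorem integral_setIntegral_Iic_mul_mixedPartial {e : (Fin k → ℝ) → ℝ} (he : Integrable e μ)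
    {u : (Fin k → ℝ) → ℝ} (hu : ContDiff ℝ k u) (hc : HasCompactSupport u) :
    ∫ y, (∫ x in Set.Iic y, e x ∂μ) * mixedPartial (fun _ => 1) u y =
      (-1) ^ k * ∫ x, e x * u x ∂μ := by
  have hD : Integrable (mixedPartial (fun _ => 1) u) :=
    (contDiff_mixedPartial (n := 0) (fun _ => 1) (by simpa using hu)).continuous
      |>.integrable_of_hasCompactSupport (hasCompactSupport_mixedPartial _ hc)
  have hint : Integrable (Function.uncurry fun (y x : Fin k → ℝ) =>
      (Set.Iic y).indicator e x * mixedPartial (fun _ => 1) u y) (volume.prod μ) := by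
    have h := (hD.mul_prod he).indicator (measurableSet_setOf_le (k := k))
    refine h.congr (ae_of_all _ fun p => ?_)
    by_cases hp : p.2 ≤ p.1
    · simp [Function.uncurry, Set.indicator, hp, mul_comm]
    · simp [Function.uncurry, Set.indicator, hp]
  calc _ = ∫ y, (∫ x, (Set.Iic y).indicator e x * mixedPartial (fun _ => 1) u y ∂μ) := by
        refine integral_congr_ae (ae_of_all _ fun y => ?_)
        simp only [integral_mul_const, integral_indicator measurableSet_Iic]
    _ = ∫ x, (∫ y, (Set.Iic y).indicator e x * mixedPartial (fun _ => 1) u y) ∂μ :=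
        integral_integral_swap hint
    _ = ∫ x, (-1) ^ k * (e x * u x) ∂μ := by
        refine integral_congr_ae (ae_of_all _ fun x => ?_)
        have h (y : Fin k → ℝ) : (Set.Iic y).indicator e x * mixedPartial (fun _ => 1) u y =
            e x * (Set.Ici x).indicator (mixedPartial (fun _ => 1) u) y := by
          by_cases hp : x ≤ y <;> simp [Set.indicator, hp]
        simp only [h]
        rw [integral_const_mul, integral_indicator measurableSet_Ici,
          setIntegral_Ici_mixedPartial_one hu hc]
        ring
    _ = _ := integral_const_mul _ _

theorem distFun_eq_setIntegral {k : ℕ} (μ : Measure (Fin k → ℝ)) (y : Fin k → ℝ) :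
     distFun μ y = ∫ _ in Set.Iic y, (1 : ℝ) ∂μ := by
  simp [distFun]

theorem measurable_distFun : Measurable (distFun μ) := by
  have h := stronglyMeasurable_setIntegral_Iic μ (e := fun _ => 1) stronglyMeasurable_const
  simp_rw [← distFun_eq_setIntegral] at h
  exact h.measurable

theorem abs_distFun_le (y : Fin k → ℝ) : |distFun μ y| ≤ 1 := by
  rw [distFun, abs_of_nonneg measureReal_nonneg]
  exact measureReal_le_one

theorem genDensity_eq_integral {u : (Fin k → ℝ) → ℝ} (hu : ContDiff ℝ k u)
    (hc : HasCompactSupport u) : genDensity μ u = ∫ x, u x ∂μ := by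
  have h := integral_setIntegral_Iic_mul_mixedPartial μ (e := fun _ => 1) (integrable_const 1) hu hc
  simp_rw [← distFun_eq_setIntegral, one_mul] at h
  rw [genDensity, h, ← mul_assoc, ← mul_pow]
  simp

/-- One derivative per coordinate is spent on turning `F` into `μ`; this makes the bias functional
an integral against `μ`. -/
theorem integral_distFun_mul_mixedPartial_add_one (m : Fin k → ℕ) {u : (Fin k → ℝ) → ℝ}
    (hu : ContDiff ℝ (∑ i, m i + k : ℕ) u) (hc : HasCompactSupport u) :
    ∫ x, distFun μ x * mixedPartial (fun i => m i + 1) u x =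
      (-1) ^ k * ∫ x, mixedPartial m u x ∂μ := by
  rw [← genDensity_eq_integral μ (contDiff_mixedPartial m (by rwa [add_comm]))
    (hasCompactSupport_mixedPartial m hc), genDensity, mixedPartial_one_mixedPartial m hu,
    ← mul_assoc, ← mul_pow]
  simp

end DistributionFunction

/-! ### Construction of a random primitive of the limit process. -/

section LimitProcess

open scoped RealInnerProductSpace ENNReal

variable {k : ℕ}

/-- The coefficient functions of the expansion are bounded but need not be square integrable for
Lebesgue measure; the weight brings them into `L²`. Its square decays with exponent `2 (k + 1) > k`.
-/
theorem exists_weight (k : ℕ) : ∃ w : (Fin k → ℝ) → ℝ, Continuous w ∧ (∀ y, 0 < w y) ∧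
    Integrable fun y => w y ^ 2 := by
  refine ⟨fun y => (1 + ‖y‖) ^ (-((k : ℝ) + 1)), ?_, fun y => by positivity, ?_⟩
  · refine Continuous.rpow_const (by fun_prop) fun y => Or.inl ?_
    positivity
  · have h := integrable_one_add_norm (E := Fin k → ℝ) (μ := volume) (r := 2 * ((k : ℝ) + 1))
      (by simp; linarith)
    refine h.congr (ae_of_all _ fun y => ?_)
    simp only
    rw [← Real.rpow_natCast, ← Real.rpow_mul (by positivity)]
    congr 1
    push_cast
    ring

/-- The vectors of the Karhunen–Loève type expansion of the centred distribution function. -/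
theorem exists_expansion (μ : Measure (Fin k → ℝ)) [IsProbabilityMeasure μ]
    {w : (Fin k → ℝ) → ℝ} (hw : Continuous w) (hw2 : Integrable fun y => w y ^ 2)
    {ι : Type*} (b : HilbertBasis ι ℝ (Lp ℝ 2 μ)) :
    ∃ a : ι → Lp ℝ 2 (volume : Measure (Fin k → ℝ)), (Summable fun i => ‖a i‖ ^ 2) ∧
      ∀ i, a i =ᵐ[volume] fun y => w y * ∫ x in Set.Iic y, (b i x - ∫ z, b i z ∂μ) ∂μ := by
  set m : ι → ℝ := fun i => ∫ z, b i z ∂μ with hm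
  set c : ι → (Fin k → ℝ) → ℝ := fun i y => ∫ x in Set.Iic y, (b i x - m i) ∂μ with hc
  have hbint (i : ι) : Integrable (b i) μ := (Lp.memLp (b i)).integrable one_le_two
  have hcm (i : ι) : StronglyMeasurable (c i) := stronglyMeasurable_setIntegral_Iic μ
    ((Lp.stronglyMeasurable (b i)).sub stronglyMeasurable_const)
  -- The centred indicator `1_{Iic y} - F(y)`; the `c i y` are its coefficients in the basis `b`.
  let f (y : Fin k → ℝ) : Lp ℝ 2 μ :=
    indicatorConstLp 2 (measurableSet_Iic (a := y)) (measure_ne_top μ _) 1 -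
      μ.real (Set.Iic y) • indicatorConstLp 2 MeasurableSet.univ (measure_ne_top μ _) 1
  have hf (i : ι) (y : Fin k → ℝ) : ⟪b i, f y⟫ = c i y := by
    rw [inner_sub_right, inner_smul_right, real_inner_comm, L2.inner_indicatorConstLp_one,
      real_inner_comm, L2.inner_indicatorConstLp_one, setIntegral_univ, hc]
    simp only
    rw [integral_sub (hbint i).integrableOn (integrable_const _)]
    simp [hm]
  have hfn (y : Fin k → ℝ) : ‖f y‖ ≤ 2 := by
    have h1 (s : Set (Fin k → ℝ)) (hs : MeasurableSet s) :
        ‖indicatorConstLp 2 hs (measure_ne_top μ s) (1 : ℝ)‖ ≤ 1 := by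
      refine norm_indicatorConstLp_le.trans ?_
      simp only [norm_one, one_mul]
      exact Real.rpow_le_one measureReal_nonneg measureReal_le_one (by positivity)
    refine (norm_sub_le _ _).trans ?_
    rw [norm_smul, Real.norm_of_nonneg measureReal_nonneg]
    have := mul_le_one₀ (measureReal_le_one (μ := μ) (s := Set.Iic y)) (norm_nonneg _)
      (h1 Set.univ MeasurableSet.univ)
    linarith [h1 (Set.Iic y) measurableSet_Iic]
  -- Bessel's inequality with `‖f y‖ ≤ 2`, uniform in `y`; integrated against `w²` it gives
  -- summability.
  have hsum (s : Finset ι) (y : Fin k → ℝ) : ∑ i ∈ s, c i y ^ 2 ≤ 4 := by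
    have h := b.orthonormal.sum_inner_products_le (x := f y) (s := s)
    simp only [hf, Real.norm_eq_abs, sq_abs] at h
    refine h.trans ?_
    nlinarith [hfn y, norm_nonneg (f y)]
  have hwc (i : ι) : MemLp (fun y => w y * c i y) 2 volume := by
    have hmeas : AEStronglyMeasurable (fun y => w y * c i y) volume :=
      hw.aestronglyMeasurable.mul (hcm i).aestronglyMeasurable
    rw [memLp_two_iff_integrable_sq hmeas]
    refine (hw2.mul_const 4).mono' (hmeas.pow 2) (ae_of_all _ fun y => ?_)
    rw [Real.norm_of_nonneg (sq_nonneg _), mul_pow]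
    gcongr
    simpa using hsum {i} y
  refine ⟨fun i => (hwc i).toLp, ?_, fun i => (hwc i).coeFn_toLp⟩
  have hnorm (i : ι) : ‖(hwc i).toLp‖ ^ 2 = ∫ y, w y ^ 2 * c i y ^ 2 := by
    rw [← real_inner_self_eq_norm_sq, L2.inner_def]
    refine integral_congr_ae ?_
    filter_upwards [(hwc i).coeFn_toLp] with y hy
    rw [hy, real_inner_self_eq_norm_sq, Real.norm_eq_abs, sq_abs, mul_pow]
  have hint (i : ι) : Integrable fun y => w y ^ 2 * c i y ^ 2 := by
    simpa [mul_pow] using (hwc i).integrable_sq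
  refine summable_of_sum_le (c := ∫ y, w y ^ 2 * 4) (fun _ => sq_nonneg _) fun s => ?_
  simp_rw [hnorm]
  rw [← integral_finsetSum _ fun i _ => hint i]
  refine integral_mono (integrable_finsetSum _ fun i _ => hint i) (hw2.mul_const 4) fun y => ?_
  simp only
  rw [← Finset.mul_sum]
  gcongr
  exact hsum s y

/-- A Gaussian white noise type process with locally integrable primitive. -/
theorem exists_gaussian_primitive (μ : Measure (Fin k → ℝ)) [IsProbabilityMeasure μ] :
    ∃ (Ω' : Type) (_ : MeasurableSpace Ω') (P' : Measure Ω') (_ : IsProbabilityMeasure P')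
      (g : Ω' → (Fin k → ℝ) → ℝ), (∀ ω, LocallyIntegrable (g ω)) ∧
      ∀ u : (Fin k → ℝ) → ℝ, ContDiff ℝ k u → HasCompactSupport u →
        Measurable (fun ω => ∫ y, mixedPartial (fun _ => 1) u y * g ω y) ∧
        HasLaw (fun ω => ∫ y, mixedPartial (fun _ => 1) u y * g ω y)
          (gaussianReal 0 Var[u; μ].toNNReal) P' := by
  obtain ⟨w, hw, hw0, hw2⟩ := exists_weight k
  obtain ⟨ι, b, -⟩ := exists_hilbertBasis ℝ (Lp ℝ 2 μ)
  obtain ⟨a, ha, hae⟩ := exists_expansion μ hw hw2 b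
  obtain ⟨Ω', mΩ', P', ξ, -, hξ, hind, hP'⟩ := exists_iid ι (gaussianReal 0 1)
  obtain ⟨G, hGm, hG⟩ := exists_random_vector_hasLaw_inner hξ hind ha
  -- Dividing by `w` undoes the weight at no cost to local integrability, and `(-1) ^ k` cancels the
  -- sign from integration by parts.
  refine ⟨Ω', mΩ', P', hP', fun ω y => (-1) ^ k * (w y)⁻¹ * G ω y, fun ω => ?_, fun u hu hc => ?_⟩
  · have h := (((Lp.memLp (G ω)).locallyIntegrable one_le_two).locallyIntegrableOn
      Set.univ).continuousOn_mul (g := fun y => (-1) ^ k * (w y)⁻¹)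
      (continuous_const.mul (hw.inv₀ fun y => (hw0 y).ne')).continuousOn isClosed_univ.isLocallyClosed
    exact locallyIntegrableOn_univ.1 h
  · have hDc : Continuous (mixedPartial (fun _ => 1) u) :=
      (contDiff_mixedPartial (n := 0) (fun _ => 1) (by simpa using hu)).continuous
    have hDs : HasCompactSupport (mixedPartial (fun _ => 1) u) := hasCompactSupport_mixedPartial _ hc
    have hT : MemLp (fun y => mixedPartial (fun _ => 1) u y * ((-1) ^ k * (w y)⁻¹)) 2 volume := by
      exact (hDc.mul (continuous_const.mul (hw.inv₀ fun y =>
        (hw0 y).ne'))).memLp_of_hasCompactSupport hDs.mul_right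
    have hZ (ω : Ω') : ∫ y, mixedPartial (fun _ => 1) u y * ((-1) ^ k * (w y)⁻¹ * G ω y) =
        ⟪hT.toLp, G ω⟫ := by
      rw [L2.inner_def]
      refine integral_congr_ae ?_
      filter_upwards [hT.coeFn_toLp] with y hy
      rw [hy]
      simp
      ring
    have hum : MemLp u 2 μ := hu.continuous.memLp_of_hasCompactSupport hc
    have hui : Integrable u μ := hum.integrable one_le_two
    have huc : MemLp (fun x => u x - ∫ z, u z ∂μ) 2 μ := hum.sub (memLp_const _)
    -- The pairing with `a i` is the `i`-th coordinate of the centred test function in `L²(μ)`, so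
    -- the sum of squares below is its variance by Parseval.
    have hinner (i : ι) : ⟪hT.toLp, a i⟫ = ⟪huc.toLp, b i⟫ := by
      have hbi : Integrable (b i) μ := (Lp.memLp (b i)).integrable one_le_two
      have hub : Integrable (fun x => u x * b i x) μ := hum.integrable_mul (Lp.memLp (b i))
      have h1 : ⟪hT.toLp, a i⟫ = (-1) ^ k * ∫ y, (∫ x in Set.Iic y, (b i x - ∫ z, b i z ∂μ) ∂μ) *
          mixedPartial (fun _ => 1) u y := by
        rw [L2.inner_def, ← integral_const_mul]
        refine integral_congr_ae ?_
        filter_upwards [hT.coeFn_toLp, hae i] with y hy hy'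
        rw [hy, hy']
        have := (hw0 y).ne'
        simp
        field_simp
      have h2 : ⟪huc.toLp, b i⟫ = ∫ x, (u x - ∫ z, u z ∂μ) * b i x ∂μ := by
        rw [L2.inner_def]
        refine integral_congr_ae ?_
        filter_upwards [huc.coeFn_toLp] with y hy
        rw [hy]
        simp [mul_comm]
      rw [h1, h2, integral_setIntegral_Iic_mul_mixedPartial μ
        (e := fun x => b i x - ∫ z, b i z ∂μ) (hbi.sub (integrable_const _)) hu hc, ← mul_assoc, ← mul_pow]
      simp_rw [sub_mul]
      rw [integral_sub (by simpa [mul_comm] using hub) (hui.const_mul _),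
        integral_sub hub (hbi.const_mul _), integral_const_mul, integral_const_mul]
      simp [mul_comm]
    have hvar : ∑' i, ⟪hT.toLp, a i⟫ ^ 2 = Var[u; μ] := by
      have h := b.tsum_inner_mul_inner huc.toLp huc.toLp
      rw [variance_eq_integral hum.1.aemeasurable]
      have h2 : ⟪huc.toLp, huc.toLp⟫ = ∫ x, (u x - ∫ z, u z ∂μ) ^ 2 ∂μ := by
        rw [L2.inner_def]
        refine integral_congr_ae ?_
        filter_upwards [huc.coeFn_toLp] with y hy
        rw [hy]
        simp
      rw [← h2, ← h]
      refine tsum_congr fun i => ?_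
      rw [hinner, pow_two, real_inner_comm huc.toLp]
    simp_rw [hZ]
    refine ⟨?_, hvar ▸ hG hT.toLp⟩
    exact ((continuous_const.inner continuous_id).comp_stronglyMeasurable hGm).measurable

end LimitProcess

/-! ### Continuous functionals on test functions, Gaussian processes and Cramér–Wold. -/

section TestSpace

variable {k : ℕ}

theorem contDiff_testFunction {r : ℕ} (ψ : TestSpace k r) {n : ℕ} (hn : n ≤ r) :
    ContDiff ℝ n ψ :=
  ψ.contDiff.of_le (by exact_mod_cast hn)

theorem exists_iterate_partialDerivCLM (j : Fin k) (a r : ℕ) :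
    ∃ T : TestSpace k (r + a) →L[ℝ] TestSpace k r, ∀ ψ, ⇑(T ψ) = (partialDeriv j)^[a] ψ := by
  induction a with
  | zero => exact ⟨ContinuousLinearMap.id ℝ _, fun ψ => rfl⟩
  | succ a ih =>
    obtain ⟨T, hT⟩ := ih
    refine ⟨T.comp (TestFunction.lineDerivCLM ℝ (Pi.single j 1)), fun ψ => ?_⟩
    rw [ContinuousLinearMap.comp_apply, hT, Function.iterate_succ_apply]
    congr 1
    ext x
    rw [TestFunction.lineDerivCLM_apply_of_le (by norm_cast)]
    rfl

theorem exists_listPartialCLM (L : List (Fin k)) (m : Fin k → ℕ) (r : ℕ) :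
    ∃ T : TestSpace k (r + (L.map m).sum) →L[ℝ] TestSpace k r, ∀ ψ, ⇑(T ψ) = listPartial L m ψ := by
  induction L generalizing r with
  | nil => exact ⟨ContinuousLinearMap.id ℝ _, fun ψ => rfl⟩
  | cons j L ih =>
    obtain ⟨T, hT⟩ := ih (r + m j)
    obtain ⟨S, hS⟩ := exists_iterate_partialDerivCLM j (m j) r
    rw [List.map_cons, List.sum_cons, ← add_assoc]
    refine ⟨S.comp T, fun ψ => ?_⟩
    rw [ContinuousLinearMap.comp_apply, hS, hT, listPartial_cons]

/-- Mixed partial derivatives are continuous linear maps between spaces of test functions. -/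
theorem exists_mixedPartialCLM (m : Fin k → ℕ) {r n : ℕ} (h : r + ∑ i, m i = n) :
    ∃ T : TestSpace k n →L[ℝ] TestSpace k r, ∀ ψ, ⇑(T ψ) = mixedPartial m ψ := by
  obtain ⟨T, hT⟩ := exists_listPartialCLM (List.finRange k) m r
  subst h
  rw [← sum_map_finRange]
  exact ⟨T, hT⟩

theorem exists_integralCLM {r : ℕ} {g : (Fin k → ℝ) → ℝ} {ν : Measure (Fin k → ℝ)}
    (hg : LocallyIntegrable g ν) :
    ∃ T : TestSpace k r →L[ℝ] ℝ, ∀ ψ, T ψ = ∫ x, ψ x * g x ∂ν := by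
  refine ⟨TestFunction.integralAgainstBilinCLM (ContinuousLinearMap.mul ℝ ℝ) ν g, fun ψ => ?_⟩
  rw [TestFunction.integralAgainstBilinCLM_eq_integral (hg.locallyIntegrableOn _)]
  rfl

theorem exists_mixedPartial_integralCLM (m : Fin k → ℕ) {n : ℕ} (h : ∑ i, m i ≤ n)
    {g : (Fin k → ℝ) → ℝ} {ν : Measure (Fin k → ℝ)} (hg : LocallyIntegrable g ν) :
    ∃ T : TestSpace k n →L[ℝ] ℝ, ∀ ψ : TestSpace k n, T ψ = ∫ x, mixedPartial m ψ x * g x ∂ν := by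
  obtain ⟨T, hT⟩ := exists_mixedPartialCLM m (Nat.sub_add_cancel h)
  obtain ⟨S, hS⟩ := exists_integralCLM (k := k) (r := n - ∑ i, m i) hg
  refine ⟨S.comp T, fun ψ => ?_⟩
  rw [ContinuousLinearMap.comp_apply, hS, hT]

theorem isGenRandomProcess_of_continuousLinearMap {r : ℕ} {Ω : Type*} [MeasurableSpace Ω]
    {Φ : TestSpace k r → Ω → ℝ} (hm : ∀ ψ, Measurable (Φ ψ))
    (h : ∀ ω, ∃ T : TestSpace k r →L[ℝ] ℝ, ∀ ψ, Φ ψ ω = T ψ) : IsGenRandomProcess Φ where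
  measurable := hm
  continuous_linear ω := by
    obtain ⟨T, hT⟩ := h ω
    exact ⟨⟨T.toLinearMap, T.cont⟩, hT⟩

theorem IsGenRandomProcess.sum_mul {r : ℕ} {Ω ι : Type*} [MeasurableSpace Ω]
    {Φ : TestSpace k r → Ω → ℝ} (h : IsGenRandomProcess Φ) (s : Finset ι) (c : ι → ℝ)
    (ψ : ι → TestSpace k r) (ω : Ω) :
    ∑ i ∈ s, c i * Φ (ψ i) ω = Φ (∑ i ∈ s, c i • ψ i) ω := by
  obtain ⟨T, hT⟩ := h.continuous_linear ω
  simp only [hT, map_sum, map_smul, smul_eq_mul]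

theorem IsGenRandomProcess.add {r : ℕ} {Ω : Type*} [MeasurableSpace Ω]
    {Φ : TestSpace k r → Ω → ℝ} (h : IsGenRandomProcess Φ) (ψ₁ ψ₂ : TestSpace k r) :
    Φ (ψ₁ + ψ₂) = Φ ψ₁ + Φ ψ₂ := by
  ext ω
  obtain ⟨T, hT⟩ := h.continuous_linear ω
  simp [hT, map_add]

/-- A generalized random process with centred Gaussian values, whose variances are those of the
test functions under `μ`, is Gaussian with the corresponding covariances. -/
theorem isGenGaussianProcess_of_hasLaw {r : ℕ} {Ω : Type*} [MeasurableSpace Ω] {P : Measure Ω}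
    [IsProbabilityMeasure P] {Z : TestSpace k r → Ω → ℝ} (hZ : IsGenRandomProcess Z)
    {μ : Measure (Fin k → ℝ)} [IsProbabilityMeasure μ]
    (hlaw : ∀ ψ : TestSpace k r, HasLaw (Z ψ) (gaussianReal 0 Var[ψ; μ].toNNReal) P) :
    IsGenGaussianProcess Z P (fun _ => 0) (fun ψ₁ ψ₂ => cov[ψ₁, ψ₂; μ]) := by
  have hmem (ψ : TestSpace k r) : MemLp (Z ψ) 2 P := by
    have := memLp_id_gaussianReal' (μ := 0) (v := Var[ψ; μ].toNNReal) 2 (by simp)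
    rw [← (hlaw ψ).map_eq] at this
    exact (memLp_map_measure_iff this.1 (hlaw ψ).aemeasurable).1 this
  have hψmem (ψ : TestSpace k r) : MemLp ψ 2 μ :=
    ψ.continuous.memLp_of_hasCompactSupport ψ.hasCompactSupport
  have hvar (ψ : TestSpace k r) : Var[Z ψ; P] = Var[ψ; μ] := by
    rw [(hlaw ψ).variance_eq, variance_id_gaussianReal, Real.coe_toNNReal _ (variance_nonneg _ _)]
  refine ⟨hZ, ⟨fun I => ⟨isGaussian_of_map_eq_gaussianReal fun L => ?_⟩⟩, fun ψ => ?_,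
    fun ψ₁ ψ₂ => ?_⟩
  · have hmeas : Measurable fun ω => I.restrict (Z · ω) :=
      measurable_pi_iff.2 fun i => hZ.measurable i
    classical
    -- By linearity of the paths, a linear form in finitely many values is one value, at a combined
    -- test function.
    have : L ∘ (fun ω => I.restrict (Z · ω)) = Z (∑ i : I, L (Pi.single i 1) • (i : TestSpace k r)) := by
      ext ω
      rw [← hZ.sum_mul Finset.univ (fun i : I => L (Pi.single i 1)) (fun i => (i : TestSpace k r)),
        Function.comp_apply]
      conv_lhs => rw [pi_eq_sum_univ' (I.restrict (Z · ω))]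
      simp [mul_comm]
    exact ⟨0, _, by rw [Measure.map_map (by fun_prop) hmeas, this, (hlaw _).map_eq]⟩
  · rw [(hlaw ψ).integral_eq, integral_id_gaussianReal]
  -- Polarization: variances at `ψ₁`, `ψ₂` and `ψ₁ + ψ₂` determine the covariance.
  · have h1 := variance_add (hmem ψ₁) (hmem ψ₂)
    have h2 := variance_add (hψmem ψ₁) (hψmem ψ₂)
    have h3 : (⇑(ψ₁ + ψ₂) : (Fin k → ℝ) → ℝ) = ⇑ψ₁ + ⇑ψ₂ := by ext; simp
    rw [← hZ.add, hvar, hvar, hvar, h3] at h1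
    linarith

theorem exists_genGaussianProcess (μ : Measure (Fin k → ℝ)) [IsProbabilityMeasure μ] {r : ℕ}
    (hr : k ≤ r) :
    ∃ (Ω' : Type) (_ : MeasurableSpace Ω') (P' : Measure Ω') (_ : IsProbabilityMeasure P')
      (Z : TestSpace k r → Ω' → ℝ),
      (∀ ψ, HasLaw (Z ψ) (gaussianReal 0 Var[ψ; μ].toNNReal) P') ∧
      IsGenGaussianProcess Z P' (fun _ => 0) (fun ψ₁ ψ₂ => cov[ψ₁, ψ₂; μ]) := by
  obtain ⟨Ω', mΩ', P', hP', g, hg, hlaw⟩ := exists_gaussian_primitive μ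
  have hψ (ψ : TestSpace k r) := hlaw ψ (contDiff_testFunction ψ hr) ψ.hasCompactSupport
  refine ⟨Ω', mΩ', P', hP', fun ψ ω => ∫ y, mixedPartial (fun _ => 1) ψ y * g ω y,
    fun ψ => (hψ ψ).2, isGenGaussianProcess_of_hasLaw
      (isGenRandomProcess_of_continuousLinearMap (fun ψ => (hψ ψ).1) fun ω => ?_)
      fun ψ => (hψ ψ).2⟩
  obtain ⟨T, hT⟩ := exists_mixedPartial_integralCLM (fun _ : Fin k => 1) (n := r) (by simpa using hr)
    (hg ω)
  exact ⟨T, fun ψ => (hT ψ).symm⟩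

theorem IsGenRandomProcess.measurable_toLp {r s : ℕ} {Ω : Type*} [MeasurableSpace Ω]
    {Φ : TestSpace k r → Ω → ℝ} (hΦ : IsGenRandomProcess Φ) (ψ : Fin s → TestSpace k r) :
    Measurable fun ω => (WithLp.toLp 2 fun i => Φ (ψ i) ω : EuclideanSpace ℝ (Fin s)) :=
  (WithLp.measurable_toLp 2 _).comp (measurable_pi_iff.2 fun i => hΦ.measurable (ψ i))

theorem IsGenRandomProcess.charFun_map_toLp {r s : ℕ} {Ω : Type*} [MeasurableSpace Ω]
    {P : Measure Ω} {Φ : TestSpace k r → Ω → ℝ} (hΦ : IsGenRandomProcess Φ)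
    (ψ : Fin s → TestSpace k r) (t : EuclideanSpace ℝ (Fin s)) :
    charFun (P.map fun ω => WithLp.toLp 2 fun i => Φ (ψ i) ω) t =
      charFun (P.map (Φ (∑ i, t i • ψ i))) 1 := by
  rw [charFun_apply, charFun_apply, integral_map (hΦ.measurable_toLp ψ).aemeasurable (by fun_prop),
    integral_map (hΦ.measurable _).aemeasurable (by fun_prop)]
  refine integral_congr_ae (ae_of_all _ fun ω => ?_)
  have h := hΦ.sum_mul Finset.univ (fun i => t i) ψ ω
  simp only [← h]
  simp [PiLp.inner_apply, mul_comm]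

/-- By linearity and the Cramér–Wold device, a sequence of generalized random processes converges
if its values at each test function converge in distribution. -/
theorem genConverges_of_tendstoInDistribution {r : ℕ} {Ω Ω' : Type*} [MeasurableSpace Ω]
    [MeasurableSpace Ω'] {Φ : ℕ → TestSpace k r → Ω → ℝ} {P : Measure Ω} [IsProbabilityMeasure P]
    {Z : TestSpace k r → Ω' → ℝ} {P' : Measure Ω'} [IsProbabilityMeasure P']
    (hΦ : ∀ n, IsGenRandomProcess (Φ n)) (hZ : IsGenRandomProcess Z)
    (h : ∀ ψ, TendstoInDistribution (fun n => Φ n ψ) atTop (Z ψ) (fun _ => P) P') :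
    GenConverges Φ P Z P' := by
  refine ⟨hΦ, hZ, fun s ψ => ?_⟩
  -- Characteristic functions need an inner product, hence the detour through `EuclideanSpace`.
  have hE : TendstoInDistribution
      (fun n ω => (WithLp.toLp 2 fun i => Φ n (ψ i) ω : EuclideanSpace ℝ (Fin s))) atTop
      (fun ω => WithLp.toLp 2 fun i => Z (ψ i) ω) (fun _ => P) P' := by
    refine ⟨fun n => ((hΦ n).measurable_toLp ψ).aemeasurable,
      (hZ.measurable_toLp ψ).aemeasurable, ?_⟩
    refine ProbabilityMeasure.tendsto_iff_tendsto_charFun.2 fun t => ?_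
    have := ProbabilityMeasure.tendsto_iff_tendsto_charFun.1 (h (∑ i, t i • ψ i)).tendsto 1
    simp only [ProbabilityMeasure.coe_mk] at this ⊢
    rw [hZ.charFun_map_toLp]
    refine this.congr fun n => ?_
    exact ((hΦ n).charFun_map_toLp ψ t).symm
  exact hE.continuous_comp (PiLp.continuous_ofLp 2 _)

end TestSpace

/-! ### Coordinatewise rescaling of Lebesgue measure. -/

section ChangeOfVariables

variable {k : ℕ}

/-- Coordinatewise multiplication by a vector without zero coordinates. -/
noncomputable def mulEquiv (h : Fin k → ℝ) (hh : ∀ j, h j ≠ 0) : (Fin k → ℝ) ≃ᵐ (Fin k → ℝ) where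
  toFun w := h * w
  invFun w := w / h
  left_inv w := by ext j; simp [hh j]
  right_inv w := by ext j; simp [mul_div_cancel₀ _ (hh j)]
  measurable_toFun := by simp only [Equiv.coe_fn_mk]; fun_prop
  measurable_invFun := by
    simp only [Equiv.coe_fn_symm_mk]
    exact measurable_pi_iff.2 fun i => (measurable_pi_apply i).div_const _

theorem volume_eq_smul_map_mul {h : Fin k → ℝ} (hh : ∀ j, 0 < h j) :
    (volume : Measure (Fin k → ℝ)) =
      ENNReal.ofReal (∏ j, h j) • volume.map (mulEquiv h fun j => (hh j).ne') := by
  have hdet : (Matrix.diagonal h).det = ∏ j, h j := Matrix.det_diagonal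
  have hpos : 0 < ∏ j, h j := Finset.prod_pos fun j _ => hh j
  have := Real.smul_map_diagonal_volume_pi (D := h) (by rw [hdet]; exact hpos.ne')
  rw [hdet, abs_of_pos hpos] at this
  conv_lhs => rw [← this]
  congr 2
  ext w j
  simp [mulEquiv, Matrix.mulVec_diagonal]

theorem integral_comp_mul {h : Fin k → ℝ} (hh : ∀ j, 0 < h j) (f : (Fin k → ℝ) → ℝ) :
    ∫ x, f x = (∏ j, h j) * ∫ w, f (h * w) := by
  conv_lhs => rw [volume_eq_smul_map_mul hh]
  rw [integral_smul_measure, integral_map_equiv,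
    ENNReal.toReal_ofReal (Finset.prod_pos fun j _ => hh j).le]
  rfl

theorem integrable_comp_div {h : Fin k → ℝ} (hh : ∀ j, 0 < h j) {f : (Fin k → ℝ) → ℝ}
    (hf : Integrable f) : Integrable fun x => f (x / h) := by
  rw [volume_eq_smul_map_mul hh]
  refine Integrable.smul_measure ?_ ENNReal.ofReal_ne_top
  rw [(mulEquiv h fun j => (hh j).ne').measurableEmbedding.integrable_map_iff]
  refine hf.congr (ae_of_all _ fun w => ?_)
  simp only [Function.comp_apply]
  congr 1
  exact ((mulEquiv h fun j => (hh j).ne').left_inv w).symm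

end ChangeOfVariables

/-! ### Kernel smoothing of test functions and its expansion in the bandwidth. -/

section Smoothing

variable {k l : ℕ} {K : (Fin k → ℝ) → ℝ}

/-- The average of `u` at the scale `h` around a point, with respect to the kernel `K`. -/
noncomputable def smoothing (K : (Fin k → ℝ) → ℝ) (h : Fin k → ℝ) (u : (Fin k → ℝ) → ℝ)
    (x : Fin k → ℝ) : ℝ :=
  ∫ w, K w * u (x - h * w)

theorem exists_bound {u : (Fin k → ℝ) → ℝ} (hu : Continuous u) (hc : HasCompactSupport u) :
    ∃ C, ∀ x, ‖u x‖ ≤ C :=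
  hu.bounded_above_of_compact_support hc

theorem integrable_mul_comp (hK : Integrable K) (h : Fin k → ℝ) {u : (Fin k → ℝ) → ℝ}
    (hu : Continuous u) (hc : HasCompactSupport u) (x : Fin k → ℝ) :
    Integrable fun w => K w * u (x - h * w) := by
  obtain ⟨C, hC⟩ := exists_bound hu hc
  exact hK.mul_bdd (c := C) (Continuous.aestronglyMeasurable (by fun_prop)) (ae_of_all _ fun w => hC _)

theorem continuous_smoothing (hK : Integrable K) (h : Fin k → ℝ) {u : (Fin k → ℝ) → ℝ}
    (hu : Continuous u) (hc : HasCompactSupport u) : Continuous (smoothing K h u) := by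
  obtain ⟨C, hC⟩ := exists_bound hu hc
  refine continuous_of_dominated (bound := fun w => ‖K w‖ * C)
    (fun x => (integrable_mul_comp hK h hu hc x).1) (fun x => ae_of_all _ fun w => ?_)
    (hK.norm.mul_const C) (ae_of_all _ fun w => by fun_prop)
  rw [norm_mul]
  gcongr
  exact hC _

theorem integral_kernel_mul {h : Fin k → ℝ} (hh : ∀ j, 0 < h j) (u : (Fin k → ℝ) → ℝ)
    (y : Fin k → ℝ) :
    ∫ x, K (fun j => (y j - x j) / h j) * u x = (∏ j, h j) * smoothing K h u y := by
  rw [← integral_sub_left_eq_self _ _ y, integral_comp_mul hh, smoothing]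
  congr 2
  ext w
  congr 2
  ext j
  simp [mul_div_cancel_left₀ _ (hh j).ne']

theorem integrable_kernel (hK : Integrable K) {h : Fin k → ℝ} (hh : ∀ j, 0 < h j) (y : Fin k → ℝ) :
    Integrable fun x : Fin k → ℝ => K (fun j => (y j - x j) / h j) :=
  (integrable_comp_div hh hK).comp_sub_left y

theorem integrable_kernelEstimator (hK : Integrable K) {h : Fin k → ℝ} (hh : ∀ j, 0 < h j) (n : ℕ)
    (obs : ℕ → Fin k → ℝ) : Integrable (kernelEstimator K h n obs) :=
  (integrable_finsetSum _ fun i _ => integrable_kernel hK hh (obs i)).const_mul _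

/-- Fixing `u` and `h`, the estimator becomes an average of one function over the observations,
which is the form the central limit theorem needs. -/
theorem integral_kernelEstimator_mul (hK : Integrable K) {h : Fin k → ℝ} (hh : ∀ j, 0 < h j)
    (n : ℕ) (obs : ℕ → Fin k → ℝ) {u : (Fin k → ℝ) → ℝ} (hu : Continuous u)
    (hc : HasCompactSupport u) :
    ∫ x, kernelEstimator K h n obs x * u x =
      (n : ℝ)⁻¹ * ∑ i ∈ Finset.range n, smoothing K h u (obs i) := by
  obtain ⟨C, hC⟩ := exists_bound hu hc
  have hint (i : ℕ) : Integrable fun x => K (fun j => (obs i j - x j) / h j) * u x :=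
    (integrable_kernel hK hh (obs i)).mul_bdd hu.aestronglyMeasurable (ae_of_all _ hC)
  simp only [kernelEstimator, mul_assoc, Finset.sum_mul]
  rw [integral_const_mul, integral_finsetSum _ fun i _ => hint i]
  simp only [integral_kernel_mul hh, ← Finset.mul_sum]
  have := (Finset.prod_pos fun j (_ : j ∈ Finset.univ) => hh j).ne'
  rcases Nat.eq_zero_or_pos n with rfl | hn
  · simp
  · field_simp

theorem abs_prod_pow_le_one {w : Fin k → ℝ} (hw : w ∈ Set.Icc (fun _ => (-1 : ℝ)) fun _ => 1)
    (m : Fin k → ℕ) : |∏ i, w i ^ m i| ≤ 1 := by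
  rw [Finset.abs_prod]
  refine Finset.prod_le_one (fun _ _ => abs_nonneg _) fun i _ => ?_
  rw [abs_pow]
  exact pow_le_one₀ (abs_nonneg _) (abs_le.2 ⟨hw.1 i, hw.2 i⟩)

/-- On the support of `K` every monomial is bounded by one. -/
theorem IsKernelOfOrder.integrable_mul_prod (hK : IsKernelOfOrder l K) (m : Fin k → ℕ) :
    Integrable fun w => K w * ∏ i, w i ^ m i := by
  refine hK.integrable.norm.mono' (hK.integrable.1.mul (Continuous.aestronglyMeasurable
    (by fun_prop))) (ae_of_all _ fun w => ?_)
  by_cases hw : K w = 0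
  · simp [hw]
  · rw [norm_mul]
    exact mul_le_of_le_one_right (norm_nonneg _) (abs_prod_pow_le_one (hK.support_subset hw) m)

/-- The contribution to the bias of the Taylor terms of order `j`. -/
noncomputable def biasTerm (K : (Fin k → ℝ) → ℝ) (j : ℕ) (h : Fin k → ℝ) (u : (Fin k → ℝ) → ℝ)
    (x : Fin k → ℝ) : ℝ :=
  ∑ m ∈ Finset.piAntidiag (Finset.univ : Finset (Fin k)) j,
    (∏ i, (-h i) ^ m i / ((m i)! : ℝ)) * mixedPartial m u x * ∫ w, K w * ∏ i, w i ^ m i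

theorem kernel_mul_taylorTerm (j : ℕ) (h : Fin k → ℝ) (u : (Fin k → ℝ) → ℝ) (x w : Fin k → ℝ) :
    K w * taylorTerm j (-(h * w)) u x = ∑ m ∈ Finset.piAntidiag (Finset.univ : Finset (Fin k)) j,
      (∏ i, (-h i) ^ m i / ((m i)! : ℝ)) * mixedPartial m u x * (K w * ∏ i, w i ^ m i) := by
  rw [taylorTerm, Finset.mul_sum]
  refine Finset.sum_congr rfl fun m _ => ?_
  have : ∏ i, (-(h * w)) i ^ m i / ((m i)! : ℝ) =
      (∏ i, (-h i) ^ m i / ((m i)! : ℝ)) * ∏ i, w i ^ m i := by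
    rw [← Finset.prod_mul_distrib]
    refine Finset.prod_congr rfl fun i _ => ?_
    rw [Pi.neg_apply, Pi.mul_apply, ← neg_mul, mul_pow]
    ring
  rw [this]
  ring

theorem IsKernelOfOrder.integrable_mul_taylorTerm (hK : IsKernelOfOrder l K) (j : ℕ)
    (h : Fin k → ℝ) (u : (Fin k → ℝ) → ℝ) (x : Fin k → ℝ) :
    Integrable fun w => K w * taylorTerm j (-(h * w)) u x := by
  simp_rw [kernel_mul_taylorTerm]
  exact integrable_finsetSum _ fun m _ => (hK.integrable_mul_prod m).const_mul _

theorem IsKernelOfOrder.integral_mul_taylorTerm (hK : IsKernelOfOrder l K) (j : ℕ)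
    (h : Fin k → ℝ) (u : (Fin k → ℝ) → ℝ) (x : Fin k → ℝ) :
    ∫ w, K w * taylorTerm j (-(h * w)) u x = biasTerm K j h u x := by
  simp_rw [kernel_mul_taylorTerm]
  rw [integral_finsetSum _ fun m _ => (hK.integrable_mul_prod m).const_mul _]
  simp only [integral_const_mul]
  rfl

/-- The degree-zero term is `u x` because `∫ K = 1`; the vanishing moments kill the degrees strictly
between `0` and `l`. -/
theorem IsKernelOfOrder.sum_biasTerm (hK : IsKernelOfOrder l K) (hl : 0 < l) (h : Fin k → ℝ)
    (u : (Fin k → ℝ) → ℝ) (x : Fin k → ℝ) :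
    ∑ j ∈ Finset.range (l + 1), biasTerm K j h u x = u x + biasTerm K l h u x := by
  rw [Finset.sum_range_succ, Finset.sum_eq_single_of_mem 0 (Finset.mem_range.2 hl)]
  · rw [← hK.integral_mul_taylorTerm 0]
    simp_rw [taylorTerm_zero]
    rw [integral_mul_const, hK.integral_eq_one, one_mul]
  · intro j hj hj0
    refine Finset.sum_eq_zero fun m hm => ?_
    have hm' : ∑ i, m i = j := (Finset.mem_piAntidiag.1 hm).1
    have := hK.moment_eq_zero m (by omega) (by rw [hm']; exact Finset.mem_range.1 hj)
    simp_rw [mul_comm (K _)]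
    rw [this, mul_zero]

theorem eventually_forall_abs_sub_le {u : (Fin k → ℝ) → ℝ} (hu : Continuous u)
    (hc : HasCompactSupport u) {ε : ℝ} (hε : 0 < ε) :
    ∀ᶠ η in 𝓝 (0 : ℝ), ∀ x v : Fin k → ℝ, ‖v‖ ≤ η → |u (x + v) - u x| ≤ ε := by
  obtain ⟨δ, hδ, h⟩ := Metric.uniformContinuous_iff.1
    (hc.uniformContinuous_of_continuous hu) ε hε
  filter_upwards [Iio_mem_nhds hδ] with η hη x v hv
  exact (h (a := x + v) (b := x) (by simpa [dist_eq_norm] using hv.trans_lt hη)).le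

theorem norm_neg_mul_le {h w : Fin k → ℝ} {η : ℝ} (hη : 0 ≤ η) (hh : ∀ j, |h j| ≤ η)
    (hw : w ∈ Set.Icc (fun _ => (-1 : ℝ)) fun _ => 1) : ‖-(h * w)‖ ≤ η := by
  rw [norm_neg, pi_norm_le_iff_of_nonneg hη]
  intro j
  rw [Pi.mul_apply, norm_mul]
  exact (mul_le_of_le_one_right (norm_nonneg _) (abs_le.2 ⟨hw.1 j, hw.2 j⟩)).trans (hh j)

theorem IsKernelOfOrder.abs_integral_mul_le (hK : IsKernelOfOrder l K) {R : (Fin k → ℝ) → ℝ} {C : ℝ}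
    (hR : ∀ w ∈ Set.Icc (fun _ => (-1 : ℝ)) fun _ => 1, |R w| ≤ C) :
    |∫ w, K w * R w| ≤ (∫ w, ‖K w‖) * C := by
  rw [← integral_mul_const]
  rw [← Real.norm_eq_abs]
  refine norm_integral_le_of_norm_le (hK.integrable.norm.mul_const C) (ae_of_all _ fun w => ?_)
  by_cases hw : K w = 0
  · simp [hw]
  · rw [norm_mul]
    gcongr
    exact hR w (hK.support_subset hw)

theorem IsKernelOfOrder.eventually_abs_smoothing_sub_le (hK : IsKernelOfOrder l K)
    {u : (Fin k → ℝ) → ℝ} (hu : Continuous u) (hc : HasCompactSupport u) {ε : ℝ} (hε : 0 < ε) :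
    ∀ᶠ η in 𝓝 (0 : ℝ), 0 ≤ η → ∀ h : Fin k → ℝ, (∀ j, |h j| ≤ η) → ∀ x,
      |smoothing K h u x - u x| ≤ ε := by
  have hI : 0 < (∫ w, ‖K w‖) + 1 := by positivity
  filter_upwards [eventually_forall_abs_sub_le hu hc (div_pos hε hI)] with η hη hη0 h hh x
  have h1 : smoothing K h u x - u x = ∫ w, K w * (u (x + -(h * w)) - u x) := by
    have h2 := integral_sub (integrable_mul_comp hK.integrable h hu hc x)
      (hK.integrable.mul_const (u x))
    rw [integral_mul_const, hK.integral_eq_one, one_mul] at h2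
    simp_rw [mul_sub, ← sub_eq_add_neg]
    exact h2.symm
  rw [h1]
  refine (hK.abs_integral_mul_le fun w hw => hη x _ (norm_neg_mul_le hη0 hh hw)).trans ?_
  rw [mul_div_assoc', div_le_iff₀ hI]
  nlinarith

/-- Taylor's formula at displacement `-h w` is integrated against `K`. Uniform continuity of the
order-`l` derivatives makes the bound uniform in `x`, so it survives integration against any `μ`. -/
theorem IsKernelOfOrder.eventually_abs_smoothing_sub_biasTerm_le (hK : IsKernelOfOrder l K)
    (hl : 0 < l) {u : (Fin k → ℝ) → ℝ} (hu : ContDiff ℝ l u) (hc : HasCompactSupport u)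
    {ε : ℝ} (hε : 0 < ε) :
    ∀ᶠ η in 𝓝 (0 : ℝ), 0 ≤ η → ∀ h : Fin k → ℝ, (∀ j, |h j| ≤ η) → ∀ x,
      |smoothing K h u x - u x - biasTerm K l h u x| ≤ ε * η ^ l := by
  set A := Finset.piAntidiag (Finset.univ : Finset (Fin k)) l with hA
  -- The constant collected from the kernel and the Taylor remainder; `+ 1` keeps the divisor
  -- positive.
  have hI : 0 < (∫ w, ‖K w‖) * (l * A.card) + 1 := by positivity
  have hev : ∀ᶠ η in 𝓝 (0 : ℝ), ∀ m ∈ A, ∀ x v : Fin k → ℝ, ‖v‖ ≤ η →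
      |mixedPartial m u (x + v) - mixedPartial m u x| ≤
        ε / ((∫ w, ‖K w‖) * (l * A.card) + 1) := by
    rw [eventually_all_finset]
    intro m hm
    have hm' : ∑ i, m i = l := (Finset.mem_piAntidiag.1 hm).1
    exact eventually_forall_abs_sub_le
      (contDiff_mixedPartial (n := 0) m (by simpa [← hm'] using hu)).continuous
      (hasCompactSupport_mixedPartial m hc) (div_pos hε hI)
  filter_upwards [hev] with η hη hη0 h hh x
  have hsum : ∑ j ∈ Finset.range (l + 1), biasTerm K j h u x =
      ∫ w, K w * ∑ j ∈ Finset.range (l + 1), taylorTerm j (-(h * w)) u x := by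
    simp_rw [Finset.mul_sum]
    rw [integral_finsetSum _ fun j _ => hK.integrable_mul_taylorTerm j h u x]
    simp_rw [hK.integral_mul_taylorTerm]
  have hR : smoothing K h u x - u x - biasTerm K l h u x = ∫ w, K w *
      (u (x + -(h * w)) - ∑ j ∈ Finset.range (l + 1), taylorTerm j (-(h * w)) u x) := by
    rw [sub_sub, ← hK.sum_biasTerm hl, hsum, smoothing, ← integral_sub]
    · simp_rw [mul_sub, ← sub_eq_add_neg]
    · exact integrable_mul_comp hK.integrable h hu.continuous hc x
    · simp_rw [Finset.mul_sum]
      exact integrable_finsetSum _ fun j _ => hK.integrable_mul_taylorTerm j h u x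
  rw [hR]
  refine (hK.abs_integral_mul_le fun w hw => abs_sub_sum_taylorTerm_le hl hu x _ (b := η)
    (fun i => (norm_le_pi_norm _ i).trans (norm_neg_mul_le hη0 hh hw)) fun m hm t ht =>
      hη m (Finset.mem_piAntidiag.2 ⟨hm, by simp⟩) x _ ?_).trans ?_
  · rw [norm_smul, Real.norm_of_nonneg ht.1]
    exact (mul_le_of_le_one_left (norm_nonneg _) ht.2).trans (norm_neg_mul_le hη0 hh hw)
  · rw [← hA]
    have h1 : (∫ w, ‖K w‖) * (l * (A.card * (η ^ l *
        (ε / ((∫ w, ‖K w‖) * (l * A.card) + 1))))) = (ε * η ^ l) *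
        (((∫ w, ‖K w‖) * (l * A.card)) / ((∫ w, ‖K w‖) * (l * A.card) + 1)) := by ring
    rw [h1]
    refine mul_le_of_le_one_right (by positivity) ?_
    rw [div_le_one hI]
    linarith

end Smoothing

/-! ### The bias functional as a mean of order-`l` Taylor terms. -/

section Bias

variable {k l : ℕ} {K : (Fin k → ℝ) → ℝ}

theorem le_maxBandwidth (h : Fin k → ℝ) (j : Fin k) : h j ≤ maxBandwidth h :=
  le_ciSup (Set.finite_range h).bddAbove j

theorem maxBandwidth_pos (hk : 0 < k) {h : Fin k → ℝ} (hh : ∀ j, 0 < h j) : 0 < maxBandwidth h :=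
  (hh ⟨0, hk⟩).trans_le (le_maxBandwidth h _)

theorem integrable_mixedPartial (μ : Measure (Fin k → ℝ)) [IsProbabilityMeasure μ] {m : Fin k → ℕ}
    {u : (Fin k → ℝ) → ℝ} (hu : ContDiff ℝ (∑ i, m i : ℕ) u) (hc : HasCompactSupport u) :
    Integrable (mixedPartial m u) μ :=
  (contDiff_mixedPartial (n := 0) m (by simpa using hu)).continuous
    |>.integrable_of_hasCompactSupport (hasCompactSupport_mixedPartial m hc)

theorem integrable_biasTerm (μ : Measure (Fin k → ℝ)) [IsProbabilityMeasure μ]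
    (K : (Fin k → ℝ) → ℝ) (h : Fin k → ℝ) {u : (Fin k → ℝ) → ℝ} (hu : ContDiff ℝ l u)
    (hc : HasCompactSupport u) : Integrable (biasTerm K l h u) μ :=
  integrable_finsetSum _ fun m hm => ((integrable_mixedPartial μ (m := m)
    (by rwa [(Finset.mem_piAntidiag.1 hm).1]) hc).const_mul _).mul_const _

/-- The sign `(-1)^(l+k)` splits: `(-1)^l` comes from the displacement `-h w`, `(-1)^k` from
integration by parts. The factor `h̄^l` cancels the normalization of the bandwidths. -/
theorem maxBandwidth_pow_mul_biasFunctional (hk : 0 < k) {h : Fin k → ℝ} (hh : ∀ j, 0 < h j)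
    (μ : Measure (Fin k → ℝ)) [IsProbabilityMeasure μ] {u : (Fin k → ℝ) → ℝ}
    (hu : ContDiff ℝ (l + k : ℕ) u) (hc : HasCompactSupport u) :
    maxBandwidth h ^ l * biasFunctional l K h μ u = ∫ x, biasTerm K l h u x ∂μ := by
  have hη := maxBandwidth_pos hk hh
  have hint (m : Fin k → ℕ) (hm : m ∈ Finset.piAntidiag (Finset.univ : Finset (Fin k)) l) :
      Integrable (mixedPartial m u) μ :=
    integrable_mixedPartial μ (by rw [(Finset.mem_piAntidiag.1 hm).1]; exact hu.of_le (by norm_cast; omega)) hc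
  simp only [biasTerm]
  rw [integral_finsetSum _ fun m hm => ((hint m hm).const_mul _).mul_const _, biasFunctional,
    Finset.mul_sum, Finset.mul_sum]
  refine Finset.sum_congr rfl fun m hm => ?_
  have hm' : ∑ i, m i = l := (Finset.mem_piAntidiag.1 hm).1
  rw [integral_mul_const, integral_const_mul,
    integral_distFun_mul_mixedPartial_add_one μ m (by rwa [hm']) hc]
  have h1 : ∏ i, (-h i) ^ m i / ((m i)! : ℝ) =
      (-1) ^ l * (maxBandwidth h ^ l * ∏ i, (h i / maxBandwidth h) ^ m i / ((m i)! : ℝ)) := by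
    rw [← hm', ← Finset.prod_pow_eq_pow_sum, ← Finset.prod_pow_eq_pow_sum, ← Finset.prod_mul_distrib,
      ← Finset.prod_mul_distrib]
    refine Finset.prod_congr rfl fun i _ => ?_
    rw [neg_pow, div_pow]
    field_simp
  rw [h1, pow_add]
  have h2 : ((-1 : ℝ) ^ k) * (-1) ^ k = 1 := by rw [← mul_pow]; simp
  linear_combination ((-1 : ℝ) ^ l * maxBandwidth h ^ l *
    (∏ i, (h i / maxBandwidth h) ^ m i / ((m i)! : ℝ)) * (∫ x, mixedPartial m u x ∂μ) *
    ∫ w, K w * ∏ i, w i ^ m i) * h2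

/-- The ratios `h i / h̄` lie in `[0, 1]`, so the bound is independent of `h`. -/
theorem exists_abs_biasFunctional_le (hk : 0 < k) (l : ℕ) (K : (Fin k → ℝ) → ℝ)
    (μ : Measure (Fin k → ℝ)) (u : (Fin k → ℝ) → ℝ) :
    ∃ C, ∀ h : Fin k → ℝ, (∀ j, 0 < h j) → |biasFunctional l K h μ u| ≤ C := by
  refine ⟨∑ m ∈ Finset.piAntidiag (Finset.univ : Finset (Fin k)) l,
    |∫ x, distFun μ x * mixedPartial (fun i => m i + 1) u x| * |∫ w, K w * ∏ i, w i ^ m i|,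
    fun h hh => ?_⟩
  have hη := maxBandwidth_pos hk hh
  rw [biasFunctional, abs_mul, abs_pow, abs_neg, abs_one, one_pow, one_mul]
  refine (Finset.abs_sum_le_sum_abs _ _).trans (Finset.sum_le_sum fun m _ => ?_)
  rw [abs_mul, abs_mul, Finset.abs_prod]
  refine mul_le_mul_of_nonneg_right (mul_le_of_le_one_left (abs_nonneg _) ?_) (abs_nonneg _)
  refine Finset.prod_le_one (fun _ _ => abs_nonneg _) fun i _ => ?_
  have h1 : (1 : ℝ) ≤ ((m i)! : ℝ) := by exact_mod_cast (Nat.factorial_pos _)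
  have h2 : 0 ≤ h i / maxBandwidth h := div_nonneg (hh i).le hη.le
  rw [abs_of_nonneg (by positivity), div_le_one (by positivity)]
  exact (pow_le_one₀ h2 ((div_le_one hη).2 (le_maxBandwidth h i))).trans h1

end Bias

/-! ### Central limit theorem for uniformly converging summands. -/

section CentralLimit

variable {E Ω Ω' : Type*} [MeasurableSpace E] {μ : Measure E}
  [MeasurableSpace Ω] {P : Measure Ω} [IsProbabilityMeasure P] [MeasurableSpace Ω']
  {P' : Measure Ω'} [IsProbabilityMeasure P'] {X : ℕ → Ω → E}

theorem memLp_of_abs_le [IsFiniteMeasure μ] {d : E → ℝ} (hd : Measurable d) {C : ℝ} (hC : ∀ x, |d x| ≤ C) :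
    MemLp d 2 μ :=
  MemLp.of_bound hd.aestronglyMeasurable C (ae_of_all _ hC)

/-- Chebyshev: by independence the normalized sum has variance at most `δ²`, whatever `n` is. -/
theorem measureReal_abs_average_sub_ge_le (hX : ∀ i, Measurable (X i))
    (hlaw : ∀ i, P.map (X i) = μ) (hind : iIndepFun X P) {d : E → ℝ} (hd : Measurable d) {δ : ℝ}
    (hδ : ∀ x, |d x| ≤ δ) (n : ℕ) {ε : ℝ} (hε : 0 < ε) :
    P.real {ω | ε ≤ |(√n)⁻¹ * ∑ i ∈ Finset.range n, d (X i ω) - √n * ∫ x, d x ∂μ|} ≤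
      δ ^ 2 / ε ^ 2 := by
  have hmem (i : ℕ) : MemLp (fun ω => d (X i ω)) 2 P :=
    memLp_of_abs_le (hd.comp (hX i)) fun ω => hδ _
  have hsum : MemLp (fun ω => (√n)⁻¹ * ∑ i ∈ Finset.range n, d (X i ω)) 2 P :=
    (memLp_finsetSum _ fun i _ => hmem i).const_mul _
  have hmean : ∫ ω, (√n)⁻¹ * ∑ i ∈ Finset.range n, d (X i ω) ∂P = √n * ∫ x, d x ∂μ := by
    have h (i : ℕ) : ∫ ω, d (X i ω) ∂P = ∫ x, d x ∂μ := by
      rw [← hlaw i, integral_map (hX i).aemeasurable hd.aestronglyMeasurable]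
    rw [integral_const_mul, integral_finsetSum _ fun i _ => (hmem i).integrable one_le_two]
    simp only [h, Finset.sum_const, Finset.card_range, nsmul_eq_mul]
    rw [← mul_assoc, inv_mul_eq_div, Real.div_sqrt]
  have hvar : Var[fun ω => (√n)⁻¹ * ∑ i ∈ Finset.range n, d (X i ω); P] ≤ δ ^ 2 := by
    have h (i : ℕ) : Var[fun ω => d (X i ω); P] ≤ δ ^ 2 := by
      have := variance_le_sq_of_bounded (a := -δ) (b := δ) (μ := P) (X := fun ω => d (X i ω))
        (ae_of_all _ fun ω => abs_le.1 (hδ _)) (hd.comp (hX i)).aemeasurable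
      convert this using 1
      ring
    have hs := IndepFun.variance_sum (s := Finset.range n) (X := fun i ω => d (X i ω))
      (fun i _ => hmem i) fun i _ j _ hij => (hind.indepFun hij).comp hd hd
    rw [variance_const_mul, ← Finset.sum_fn, hs, inv_pow, Real.sq_sqrt (Nat.cast_nonneg n)]
    rcases Nat.eq_zero_or_pos n with rfl | hn
    · simpa using sq_nonneg δ
    · have hn' : (0 : ℝ) < n := by exact_mod_cast hn
      rw [inv_mul_le_iff₀ hn']
      calc _ ≤ ∑ i ∈ Finset.range n, δ ^ 2 := Finset.sum_le_sum fun i _ => h i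
        _ = _ := by simp
  have hch := meas_ge_le_variance_div_sq hsum hε
  rw [hmean] at hch
  refine ENNReal.toReal_le_of_le_ofReal (by positivity) (hch.trans (ENNReal.ofReal_le_ofReal ?_))
  gcongr

/-- A central limit theorem for averages of functions that converge uniformly, with a
deterministic correction of the centring. -/
theorem tendstoInDistribution_sqrt_mul_average_sub [IsProbabilityMeasure μ]
    (hX : ∀ i, Measurable (X i))
    (hlaw : ∀ i, P.map (X i) = μ) (hind : iIndepFun X P) {u : E → ℝ} (hu : Measurable u) {C : ℝ}
    (hC : ∀ x, |u x| ≤ C) {s : ℕ → E → ℝ} (hs : ∀ n, Measurable (s n))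
    (hsu : ∀ δ > 0, ∀ᶠ n in atTop, ∀ x, |s n x - u x| ≤ δ) {c : ℕ → ℝ}
    (hc : Tendsto (fun n : ℕ => √n * (∫ x, s n x ∂μ - ∫ x, u x ∂μ - c n)) atTop (𝓝 0))
    {Z : Ω' → ℝ} (hZ : HasLaw Z (gaussianReal 0 Var[u; μ].toNNReal) P') :
    TendstoInDistribution (fun (n : ℕ) ω => √n * ((n : ℝ)⁻¹ * ∑ i ∈ Finset.range n, s n (X i ω)
      - ∫ x, u x ∂μ - c n)) atTop Z (fun _ => P) P' := by
  have humem : MemLp u 2 μ := memLp_of_abs_le hu hC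
  have hmean : ∫ ω, u (X 0 ω) ∂P = ∫ x, u x ∂μ := by
    rw [← hlaw 0, integral_map (hX 0).aemeasurable hu.aestronglyMeasurable]
  have hvar : Var[fun ω => u (X 0 ω); P] = Var[u; μ] := by
    rw [← hlaw 0, variance_map hu.aemeasurable (hX 0).aemeasurable]
    rfl
  have hclt := tendstoInDistribution_inv_sqrt_mul_sum_sub (P := P) (P' := P') (Y := Z)
    (X := fun i ω => u (X i ω)) (by rwa [hvar]) (memLp_of_abs_le (hu.comp (hX 0)) fun ω => hC _)
    (hind.comp (fun _ => u) fun _ => hu) fun i =>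
      (IdentDistrib.mk (hX i).aemeasurable (hX 0).aemeasurable (by rw [hlaw, hlaw])).comp hu
  rw [hmean] at hclt
  -- Slutsky: it suffices that the difference from the classical sum for `u` tends to zero in
  -- measure.
  refine tendstoInDistribution_of_tendstoInMeasure_sub _ Z hclt ?_ fun n => ?_
  · rw [tendstoInMeasure_iff_measureReal_norm]
    intro ε hε
    rw [tendsto_order]
    refine ⟨fun a ha => Eventually.of_forall fun n => ha.trans_le measureReal_nonneg,
      fun a ha => ?_⟩
    obtain ⟨a', ha'0, ha'⟩ := exists_between ha
    -- Chosen so that Chebyshev at level `ε / 2` gives exactly `a'`; the other `ε / 2` is for the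
    -- deterministic term.
    have hδ : 0 < ε / 2 * √a' := mul_pos (by positivity) (Real.sqrt_pos.2 ha'0)
    have hb : ∀ᶠ n : ℕ in atTop, |√n * (∫ x, s n x ∂μ - ∫ x, u x ∂μ - c n)| < ε / 2 := by
      have := (tendsto_order.1 hc.norm).2 (ε / 2) (by simpa using hε)
      simpa using this
    filter_upwards [hsu _ hδ, hb, eventually_gt_atTop 0] with n hn hbn hn0
    have hdm : Measurable fun x => s n x - u x := (hs n).sub hu
    have hdint : Integrable (fun x => s n x - u x) μ :=
      (memLp_of_abs_le hdm hn).integrable one_le_two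
    have huint : Integrable u μ := humem.integrable one_le_two
    have hsint : Integrable (s n) μ :=
      (hdint.add huint).congr (ae_of_all _ fun x => by simp)
    have hle := measureReal_abs_average_sub_ge_le hX hlaw hind hdm hn n (half_pos hε)
    have hval : (ε / 2 * √a') ^ 2 / (ε / 2) ^ 2 = a' := by
      rw [mul_pow, Real.sq_sqrt ha'0.le, mul_div_cancel_left₀ _ (by positivity)]
    rw [hval] at hle
    refine lt_of_le_of_lt (le_trans (measureReal_mono ?_) hle) ha'
    intro ω hω
    simp only [Set.mem_ofPred_eq, Pi.sub_apply, Pi.zero_apply, sub_zero, Real.norm_eq_abs] at hω ⊢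
    have hsq : √(n : ℝ) * (n : ℝ)⁻¹ = (√(n : ℝ))⁻¹ := by
      rw [← div_eq_mul_inv, Real.sqrt_div_self]
    have hsq2 : (√(n : ℝ))⁻¹ * n = √(n : ℝ) := by rw [inv_mul_eq_div, Real.div_sqrt]
    have hdec : √n * ((n : ℝ)⁻¹ * ∑ i ∈ Finset.range n, s n (X i ω) - ∫ x, u x ∂μ - c n) -
        (√n)⁻¹ * (∑ i ∈ Finset.range n, u (X i ω) - n * ∫ x, u x ∂μ) =
        ((√n)⁻¹ * ∑ i ∈ Finset.range n, (s n (X i ω) - u (X i ω)) -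
          √n * ∫ x, (s n x - u x) ∂μ) + √n * (∫ x, s n x ∂μ - ∫ x, u x ∂μ - c n) := by
      rw [integral_sub hsint huint, Finset.sum_sub_distrib]
      linear_combination (∑ i ∈ Finset.range n, s n (X i ω)) * hsq + (∫ x, u x ∂μ) * hsq2
    rw [hdec] at hω
    have := hω.trans (abs_add_le _ _)
    linarith
  · refine Measurable.aemeasurable ?_
    have (i : ℕ) : Measurable fun ω => s n (X i ω) := (hs n).comp (hX i)
    fun_prop

end CentralLimit

/-! ### The rescaled estimator as a generalized random process. -/

section Processes

variable {k l : ℕ} {K : (Fin k → ℝ) → ℝ}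

theorem locallyIntegrable_distFun (μ : Measure (Fin k → ℝ)) [IsProbabilityMeasure μ] :
    LocallyIntegrable (distFun μ) :=
  (memLp_top_of_bound (measurable_distFun μ).aestronglyMeasurable 1
    (ae_of_all _ (abs_distFun_le μ))).locallyIntegrable le_top

theorem exists_genDensityCLM (μ : Measure (Fin k → ℝ)) [IsProbabilityMeasure μ] {r : ℕ}
    (hr : k ≤ r) : ∃ T : TestSpace k r →L[ℝ] ℝ, ∀ ψ : TestSpace k r, T ψ = genDensity μ ψ := by
  obtain ⟨T, hT⟩ := exists_mixedPartial_integralCLM (fun _ : Fin k => 1) (n := r) (by simpa using hr)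
    (locallyIntegrable_distFun μ)
  refine ⟨(-1 : ℝ) ^ k • T, fun ψ => ?_⟩
  simp [hT, genDensity, mul_comm]

theorem exists_biasFunctionalCLM (l : ℕ) (K : (Fin k → ℝ) → ℝ) (h : Fin k → ℝ)
    (μ : Measure (Fin k → ℝ)) [IsProbabilityMeasure μ] :
    ∃ T : TestSpace k (l + k) →L[ℝ] ℝ, ∀ ψ : TestSpace k (l + k),
      T ψ = biasFunctional l K h μ ψ := by
  have key (m : Fin k → ℕ) : ∃ T : TestSpace k (l + k) →L[ℝ] ℝ, ∑ i, m i = l →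
      ∀ ψ : TestSpace k (l + k), T ψ = ∫ x, distFun μ x * mixedPartial (fun i => m i + 1) ψ x := by
    by_cases hm : ∑ i, m i = l
    · obtain ⟨T, hT⟩ := exists_mixedPartial_integralCLM (fun i => m i + 1) (n := l + k)
        (by simp [Finset.sum_add_distrib, hm]) (locallyIntegrable_distFun μ)
      exact ⟨T, fun _ ψ => by rw [hT]; simp only [mul_comm]⟩
    · exact ⟨0, fun h => absurd h hm⟩
  choose T hT using key
  refine ⟨(-1 : ℝ) ^ (l + k) • ∑ m ∈ Finset.piAntidiag (Finset.univ : Finset (Fin k)) l,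
    ((∏ i, (h i / maxBandwidth h) ^ m i / ((m i)! : ℝ)) * ∫ w, K w * ∏ i, w i ^ m i) • T m,
    fun ψ => ?_⟩
  simp only [smul_apply, sum_apply, smul_eq_mul,
    biasFunctional]
  congr 1
  refine Finset.sum_congr rfl fun m hm => ?_
  rw [hT m (Finset.mem_piAntidiag.1 hm).1]
  ring

theorem exists_kernelEstimatorCLM (hK : Integrable K) {h : Fin k → ℝ} (hh : ∀ j, 0 < h j) (n : ℕ)
    (obs : ℕ → Fin k → ℝ) (r : ℕ) :
    ∃ T : TestSpace k r →L[ℝ] ℝ, ∀ ψ : TestSpace k r,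
      T ψ = ∫ x, kernelEstimator K h n obs x * ψ x := by
  obtain ⟨T, hT⟩ := exists_integralCLM (k := k) (r := r)
    (integrable_kernelEstimator hK hh n obs).locallyIntegrable
  exact ⟨T, fun ψ => by rw [hT]; simp only [mul_comm]⟩

/-- The rescaled kernel density estimator, centred at the generalized density and a multiple of
the bias functional, is a generalized random process. -/
theorem isGenRandomProcess_kernelEstimator (hK : Integrable K) (μ : Measure (Fin k → ℝ))
    [IsProbabilityMeasure μ] {Ω : Type*} [MeasurableSpace Ω] {X : ℕ → Ω → Fin k → ℝ}
    (hX : ∀ i, Measurable (X i)) {h : Fin k → ℝ} (hh : ∀ j, 0 < h j) (n : ℕ) (a b : ℝ) :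
    IsGenRandomProcess (fun (ψ : TestSpace k (l + k)) ω => a *
      ((∫ x, kernelEstimator K h n (fun i => X i ω) x * ψ x) - genDensity μ ψ
        - b * biasFunctional l K h μ ψ)) := by
  refine isGenRandomProcess_of_continuousLinearMap (fun ψ => ?_) fun ω => ?_
  · simp_rw [integral_kernelEstimator_mul hK hh n _ ψ.continuous ψ.hasCompactSupport]
    have (i : ℕ) : Measurable fun ω => smoothing K h ψ (X i ω) :=
      (continuous_smoothing hK h ψ.continuous ψ.hasCompactSupport).measurable.comp (hX i)
    fun_prop
  · obtain ⟨T₁, h₁⟩ := exists_kernelEstimatorCLM hK hh n (fun i => X i ω) (l + k)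
    obtain ⟨T₂, h₂⟩ := exists_genDensityCLM μ (Nat.le_add_left k l)
    obtain ⟨T₃, h₃⟩ := exists_biasFunctionalCLM l K h μ
    exact ⟨a • (T₁ - T₂ - b • T₃), fun ψ => by simp [h₁, h₂, h₃]⟩

end Processes

/-! ### Control of the bias and convergence at one test function. -/

section Convergence

variable {k l : ℕ} {K : (Fin k → ℝ) → ℝ}

/-- The remainder is `o(h̄^l)`, while `√n h̄^l` is bounded as the square root of `n h̄^{2l}`. -/
theorem tendsto_sqrt_mul_integral_smoothing_sub (hk : 0 < k) (hl : 0 < l)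
    (hK : IsKernelOfOrder l K) (μ : Measure (Fin k → ℝ)) [IsProbabilityMeasure μ]
    {h : ℕ → Fin k → ℝ} (hpos : ∀ n j, 0 < h n j)
    (hlim : Tendsto (fun n => maxBandwidth (h n)) atTop (𝓝 0))
    (hO : (fun n : ℕ => (n : ℝ) * maxBandwidth (h n) ^ (2 * l)) =O[atTop] (fun _ => (1 : ℝ)))
    {u : (Fin k → ℝ) → ℝ} (hu : ContDiff ℝ (l + k : ℕ) u) (hc : HasCompactSupport u) :
    Tendsto (fun n : ℕ => √n * (∫ x, smoothing K (h n) u x ∂μ - ∫ x, u x ∂μ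
      - maxBandwidth (h n) ^ l * biasFunctional l K (h n) μ u)) atTop (𝓝 0) := by
  have hul : ContDiff ℝ l u := hu.of_le (by norm_cast; omega)
  obtain ⟨C, hC⟩ := hO.bound
  rw [Metric.tendsto_nhds]
  intro ε hε
  have hC1 : 0 < √|C| + 1 := by positivity
  filter_upwards [hC, hlim.eventually (hK.eventually_abs_smoothing_sub_biasTerm_le hl hul hc
    (div_pos hε hC1))] with n hn hs
  have hη : 0 < maxBandwidth (h n) := maxBandwidth_pos hk (hpos n)
  specialize hs hη.le (h n) fun j => by
    rw [abs_of_pos (hpos n j)]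
    exact le_maxBandwidth _ j
  have h1 : Integrable (smoothing K (h n) u) μ := by
    have hi : Integrable (fun x => smoothing K (h n) u x - u x - biasTerm K l (h n) u x) μ := by
      refine Integrable.of_bound ?_ _ (ae_of_all _ hs)
      exact (((continuous_smoothing hK.integrable _ hu.continuous hc).aestronglyMeasurable).sub
        hu.continuous.aestronglyMeasurable).sub (integrable_biasTerm μ K (h n) hul hc).1
    exact ((hi.add (integrable_biasTerm μ K (h n) hul hc)).add
      (hu.continuous.integrable_of_hasCompactSupport (μ := μ) hc)).congr
      (ae_of_all _ fun x => by simp)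
  have h2 : Integrable u μ := hu.continuous.integrable_of_hasCompactSupport hc
  rw [maxBandwidth_pow_mul_biasFunctional hk (hpos n) μ hu hc, ← integral_sub h1 h2,
    ← integral_sub (f := fun x => smoothing K (h n) u x - u x) (h1.sub h2)
      (integrable_biasTerm μ K (h n) hul hc), dist_zero_right, norm_mul,
    Real.norm_of_nonneg (Real.sqrt_nonneg _)]
  have h3 : ‖∫ x, (smoothing K (h n) u x - u x - biasTerm K l (h n) u x) ∂μ‖ ≤
      ε / (√|C| + 1) * maxBandwidth (h n) ^ l := by
    simpa using norm_integral_le_of_norm_le_const (μ := μ)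
      (f := fun x => smoothing K (h n) u x - u x - biasTerm K l (h n) u x) (ae_of_all _ hs)
  have h4 : √n * maxBandwidth (h n) ^ l ≤ √|C| := by
    refine Real.le_sqrt_of_sq_le ?_
    rw [mul_pow, Real.sq_sqrt (Nat.cast_nonneg n), ← pow_mul, mul_comm l]
    refine (le_abs_self _).trans ((by simpa using hn : _ ≤ C).trans (le_abs_self C))
  calc _ ≤ √n * (ε / (√|C| + 1) * maxBandwidth (h n) ^ l) := by gcongr
    _ = (√n * maxBandwidth (h n) ^ l) * (ε / (√|C| + 1)) := by ring
    _ ≤ √|C| * (ε / (√|C| + 1)) := by gcongr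
    _ = ε * √|C| / (√|C| + 1) := by ring
    _ < ε := by
      rw [div_lt_iff₀ hC1]
      nlinarith

theorem tendsto_sqrt_mul_maxBandwidth_pow_mul_biasFunctional (hk : 0 < k) (l : ℕ)
    (K : (Fin k → ℝ) → ℝ) (μ : Measure (Fin k → ℝ)) {h : ℕ → Fin k → ℝ} (hpos : ∀ n j, 0 < h n j)
    (ho : Tendsto (fun n : ℕ => (n : ℝ) * maxBandwidth (h n) ^ (2 * l)) atTop (𝓝 0))
    (u : (Fin k → ℝ) → ℝ) :
    Tendsto (fun n : ℕ => √n * (maxBandwidth (h n) ^ l * biasFunctional l K (h n) μ u)) atTop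
      (𝓝 0) := by
  obtain ⟨C, hC⟩ := exists_abs_biasFunctional_le hk l K μ u
  have h1 : Tendsto (fun n : ℕ => √((n : ℝ) * maxBandwidth (h n) ^ (2 * l)) * C) atTop (𝓝 0) := by
    simpa using ((Real.continuous_sqrt.tendsto _).comp ho).mul_const C
  refine squeeze_zero_norm (fun n => ?_) h1
  have hη : 0 < maxBandwidth (h n) := maxBandwidth_pos hk (hpos n)
  rw [Real.sqrt_mul (Nat.cast_nonneg n), mul_comm 2 l, pow_mul, Real.sqrt_sq (by positivity),
    norm_mul, norm_mul, Real.norm_of_nonneg (Real.sqrt_nonneg _),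
    Real.norm_of_nonneg (pow_nonneg hη.le l), mul_assoc]
  gcongr
  exact hC _ (hpos n)

/-- For `l = 0` the quantity is `n` itself, so the bandwidth condition forces the `l > 0` that the
Taylor argument needs. -/
theorem not_isBigO_mul_pow_two_mul_zero (f : ℕ → ℝ) :
    ¬ (fun n : ℕ => (n : ℝ) * f n ^ (2 * 0)) =O[atTop] (fun _ => (1 : ℝ)) := by
  intro hO
  obtain ⟨C, hC⟩ := hO.bound
  obtain ⟨n, hn, hn'⟩ := (hC.and (tendsto_natCast_atTop_atTop.eventually_gt_atTop C)).exists
  simp only [mul_zero, pow_zero, mul_one, Real.norm_eq_abs, Nat.abs_cast, abs_one] at hn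
  linarith

/-- If the bias is `c n` up to `o(1 / √n)`, then the rescaled kernel density estimator centred at
the generalized density and `c n` converges in distribution at each test function. -/
theorem tendstoInDistribution_kernelEstimator (hk : 0 < k) (hK : IsKernelOfOrder l K)
    {μ : Measure (Fin k → ℝ)} [IsProbabilityMeasure μ] {Ω Ω' : Type*} [MeasurableSpace Ω]
    {P : Measure Ω} [IsProbabilityMeasure P] [MeasurableSpace Ω'] {P' : Measure Ω'}
    [IsProbabilityMeasure P'] {X : ℕ → Ω → Fin k → ℝ} (hX : ∀ i, Measurable (X i))
    (hlaw : ∀ i, P.map (X i) = μ) (hind : iIndepFun X P)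
    {h : ℕ → Fin k → ℝ} (hpos : ∀ n j, 0 < h n j)
    (hlim : Tendsto (fun n => maxBandwidth (h n)) atTop (𝓝 0)) {u : (Fin k → ℝ) → ℝ}
    (hu : ContDiff ℝ k u) (hc : HasCompactSupport u) {c : ℕ → ℝ}
    (hb : Tendsto (fun n : ℕ => √n * (∫ x, smoothing K (h n) u x ∂μ - ∫ x, u x ∂μ - c n)) atTop
      (𝓝 0))
    {Z : Ω' → ℝ} (hZ : HasLaw Z (gaussianReal 0 Var[u; μ].toNNReal) P') :
    TendstoInDistribution (fun (n : ℕ) ω => √n *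
      ((∫ x, kernelEstimator K (h n) n (fun i => X i ω) x * u x) - genDensity μ u - c n))
      atTop Z (fun _ => P) P' := by
  obtain ⟨C, hC⟩ := exists_bound hu.continuous hc
  simp_rw [integral_kernelEstimator_mul hK.integrable (hpos _) _ _ hu.continuous hc,
    genDensity_eq_integral μ hu hc]
  refine tendstoInDistribution_sqrt_mul_average_sub hX hlaw hind hu.continuous.measurable hC
    (fun n => (continuous_smoothing hK.integrable (h n) hu.continuous hc).measurable)
    (fun δ hδ => ?_) hb hZ
  filter_upwards [hlim.eventually (hK.eventually_abs_smoothing_sub_le hu.continuous hc hδ)]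
    with n hn
  refine hn (maxBandwidth_pos hk (hpos n)).le (h n) fun j => ?_
  rw [abs_of_pos (hpos n j)]
  exact le_maxBandwidth _ j

end Convergence

end GenDensity

/-! ### The main theorem, with one limit process for both regimes. -/

theorem theorem2 {k l : ℕ} (hk : 0 < k)
    (K : (Fin k → ℝ) → ℝ) (hK : GenDensity.IsKernelOfOrder l K)
    (μ : Measure (Fin k → ℝ)) [IsProbabilityMeasure μ]
    {Ω : Type*} [MeasurableSpace Ω] (P : Measure Ω) [IsProbabilityMeasure P]
    (X : ℕ → Ω → Fin k → ℝ) (hX : ∀ i, Measurable (X i)) (hXlaw : ∀ i, P.map (X i) = μ)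
    (hXindep : iIndepFun X P)
    (h : ℕ → Fin k → ℝ) (hpos : ∀ n j, 0 < h n j)
    (hlim : Tendsto (fun n => GenDensity.maxBandwidth (h n)) atTop (𝓝 0)) :
    ∃ (Ω' : Type) (_ : MeasurableSpace Ω') (P' : Measure Ω') (_ : IsProbabilityMeasure P')
      (Z : GenDensity.TestSpace k (l + k) → Ω' → ℝ),
      GenDensity.IsGenGaussianProcess Z P' (fun _ => 0) (fun ψ₁ ψ₂ => cov[ψ₁, ψ₂; μ]) ∧
      ((fun n : ℕ => (n : ℝ) * GenDensity.maxBandwidth (h n) ^ (2 * l))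
          =O[atTop] (fun _ => (1 : ℝ)) →
        GenDensity.GenConverges
          (fun n ψ ω => √(n : ℝ) *
            ((∫ x, GenDensity.kernelEstimator K (h n) n (fun i => X i ω) x * ψ x)
              - GenDensity.genDensity μ ψ
              - GenDensity.maxBandwidth (h n) ^ l * GenDensity.biasFunctional l K (h n) μ ψ))
          P Z P') ∧
      (Tendsto (fun n : ℕ => (n : ℝ) * GenDensity.maxBandwidth (h n) ^ (2 * l)) atTop (𝓝 0) →
        GenDensity.GenConverges
          (fun n ψ ω => √(n : ℝ) *
            ((∫ x, GenDensity.kernelEstimator K (h n) n (fun i => X i ω) x * ψ x)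
              - GenDensity.genDensity μ ψ))
          P Z P') := by
  obtain ⟨Ω', mΩ', P', hP', Z, hZ, hZG⟩ :=
    GenDensity.exists_genGaussianProcess μ (Nat.le_add_left k l)
  have hbias (hO : (fun n : ℕ => (n : ℝ) * GenDensity.maxBandwidth (h n) ^ (2 * l))
      =O[atTop] (fun _ => (1 : ℝ))) (ψ : GenDensity.TestSpace k (l + k)) :
      Tendsto (fun n : ℕ => √n * (∫ x, GenDensity.smoothing K (h n) ψ x ∂μ - ∫ x, ψ x ∂μ
        - GenDensity.maxBandwidth (h n) ^ l * GenDensity.biasFunctional l K (h n) μ ψ))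
        atTop (𝓝 0) := by
    have hl : 0 < l := by
      refine Nat.pos_of_ne_zero fun h0 => ?_
      subst h0
      exact GenDensity.not_isBigO_mul_pow_two_mul_zero _ hO
    exact GenDensity.tendsto_sqrt_mul_integral_smoothing_sub hk hl hK μ hpos hlim hO
      (GenDensity.contDiff_testFunction ψ le_rfl) ψ.hasCompactSupport
  refine ⟨Ω', mΩ', P', hP', Z, hZG, fun hO => ?_, fun ho => ?_⟩
  · refine GenDensity.genConverges_of_tendstoInDistribution
      (fun n => GenDensity.isGenRandomProcess_kernelEstimator hK.integrable μ hX (hpos n) n _ _)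
      hZG.isGenRandomProcess fun ψ => ?_
    exact GenDensity.tendstoInDistribution_kernelEstimator hk hK hX hXlaw hXindep hpos hlim
      (GenDensity.contDiff_testFunction ψ (Nat.le_add_left k l)) ψ.hasCompactSupport (hbias hO ψ)
      (hZ ψ)
  · refine GenDensity.genConverges_of_tendstoInDistribution (fun n => ?_)
      hZG.isGenRandomProcess fun ψ => ?_
    · simpa using GenDensity.isGenRandomProcess_kernelEstimator (l := l) hK.integrable μ hX
        (hpos n) n (√n) 0
    · have hO : (fun n : ℕ => (n : ℝ) * GenDensity.maxBandwidth (h n) ^ (2 * l))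
          =O[atTop] (fun _ => (1 : ℝ)) := ho.isBigO_one ℝ
      -- Adding back the negligible term in `B` shows that the whole bias is `o(1 / √n)`, so no
      -- correction is needed.
      have hb := (hbias hO ψ).add
        (GenDensity.tendsto_sqrt_mul_maxBandwidth_pow_mul_biasFunctional hk l K μ hpos ho ψ)
      have := GenDensity.tendstoInDistribution_kernelEstimator hk hK hX hXlaw hXindep hpos hlim
        (GenDensity.contDiff_testFunction ψ (Nat.le_add_left k l)) ψ.hasCompactSupport
        (c := fun _ => 0) (by
          refine (add_zero (0 : ℝ) ▸ hb).congr fun n => ?_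
          ring) (hZ ψ)
      simpa using this
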